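/- **Model.** Let $L\ge 1$, and let $\mathbf W_i=(W_{i1},\dots,W_{iL})$, $i\ge 1$, be i.i.d. random vectors in $\mathbb R_+^L=[0,\infty)^L$, distributed as $\mathbf W=(W_1,\dots,W_L)$. For each layer $l$ let $g_l:\mathbb R_+\to\mathbb R_+$ be Borel measurable. For $N\ge 1$ put $T_l(N)=\sum_{i=1}^N W_{il}$. The $L$-layer multilayer inhomogeneous random graph (MIRG) on $N$ nodes is an array $(A_{ijl})_{i,j\le N,\ l\le L}$ of $\mathbb N_0$-valued random variables with $A_{ijl}=A_{jil}$ such that, conditionally on $\mathbf W_1,\dots,\mathbf W_N$, the variables $A_{ijl}$ ($1\le i\le j\le N$, $1\le l\le L$) are independent with $$A_{ijl}\sim\operatorname{Poisson}\Big(g_l\Big(\frac{W_{il}W_{jl}}{T_l(N)}\Big)\Big)$$ (with $0/0:=0$). The degree of node $i$ in layer $l$ is $D_{il}(N)=\sum_{j=1}^N A_{ijl}$. **Assumptions.** Let $\alpha>0$ and let $s,m$ be layers. 1. $\mathbf W$ is multivariate regularly varying with index $\alpha$ on $\mathbb R_+^L\setminus\{\mathbf 0\}$: there are a function $b$ that is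 regularly varying at infinity with index $1/\alpha$ and a nonzero Borel measure $\nu$ on $\mathbb R_+^L\setminus\{\mathbf 0\}$, finite on sets bounded away from $\mathbf 0$, such that $t\,\mathbb E f(\mathbf W/b(t))\to\int f\,d\nu$ as $t\to\infty$ for every bounded continuous $f\ge 0$ on $\mathbb R_+^L\setminus\{\mathbf 0\}$ whose support is bounded away from $\mathbf 0$. Moreover $\nu(\{x: x_l>0\})>0$ for $l=s,m$, i.e. $W_s$ and $W_m$ have regularly varying tails of index $\alpha$ on the common scale $b$. 2. For $l=s,m$: $g_l(x)/x\to1$ as $x\downarrow0$, and $g_l(x)\le C_l x$ for all $x\ge0$ and some constant $C_l<\infty$; if $\mathbb E W_l=\infty$ (possible only for $\alpha\le1$), also $g_l(x)/x\to1$ as $x\to\infty$. (For example, $g_l(x)=x$ is allowed for every $\alpha>0$.) 3. $(t_N)$ is an intermediate sequence: $t_N$ are integers with $t_N\to\infty$ and $t_N/N\to0$. 4. The upper tail dependence coefficient of the weights exists: $$\lambda_U^{s,m}=\lim_{q\to1^-}\mathbb P\big(W_m>F_m^{-1}(q)\,\big|\,W_s>F_s^{-1}(q)\big),$$ where $F_l$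 is the distribution function of $W_l$ and $F^{-1}(p)=\inf\{x:F(x)\ge p\}$. **Conclusion.** Let $\hat G_{l,N}(x)=\frac1N\sum_{i=1}^N\mathbf 1\{D_{il}(N)\le x\}$, let $\hat u_{l,N}=\hat G_{l,N}^{-1}(1-t_N/N)$, and $$\hat\lambda^{s,m}_{D(N)}=\frac{\sum_{i=1}^N\mathbf 1\{D_{is}(N)>\hat u_{s,N},\ D_{im}(N)>\hat u_{m,N}\}}{\sum_{i=1}^N\mathbf 1\{D_{is}(N)>\hat u_{s,N}\}}$$ (with $0/0:=0$). Then $\hat\lambda^{s,m}_{D(N)}\to\lambda_U^{s,m}$ in probability as $N\to\infty$. -/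

import Mathlib

open MeasureTheory ProbabilityTheory Filter Topology
open scoped NNReal ENNReal BoundedContinuousFunction

namespace MIRG

/-- The closed cone `ℝ₊ᴸ = [0,∞)ᴸ`. -/
abbrev Cone (L : ℕ) : Type := Fin L → ℝ≥0

/-- The class `𝕄(ℝ₊ᴸ ∖ {0})`: Borel measures on `ℝ₊ᴸ ∖ {0}` (encoded as measures on `ℝ₊ᴸ`
giving no mass to the origin) that are finite on sets bounded away from the origin. -/
structure IsMMeasure {L : ℕ} (ν : Measure (Cone L)) : Prop where
  null_zero : ν {0} = 0
  finite_away : ∀ ε : ℝ, 0 < ε → ν {x | ε ≤ dist x 0} < ∞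

/-- `𝕄`-convergence on `ℝ₊ᴸ ∖ {0}`: convergence of integrals of all bounded continuous
non-negative functions whose support is bounded away from the origin (such a function on
`ℝ₊ᴸ ∖ {0}` is the same thing as a continuous function on `ℝ₊ᴸ` vanishing near the origin). -/
def MTendsto {ι : Type*} {L : ℕ} (m : ι → Measure (Cone L)) (l : Filter ι)
    (ν : Measure (Cone L)) : Prop :=
  ∀ f : Cone L →ᵇ ℝ≥0, (∃ ε : ℝ, 0 < ε ∧ ∀ x, dist x 0 < ε → f x = 0) →
    Tendsto (fun i => ∫⁻ x, (f x : ℝ≥0∞) ∂(m i)) l (𝓝 (∫⁻ x, (f x : ℝ≥0∞) ∂ν))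

/-- `b ∈ RV_ρ`: `b` is regularly varying at infinity with index `ρ`. -/
structure RegularlyVarying (b : ℝ≥0 → ℝ≥0) (ρ : ℝ) : Prop where
  measurable : Measurable b
  eventually_pos : ∀ᶠ t in atTop, 0 < b t
  tendsto_ratio : ∀ c : ℝ≥0, 0 < c → Tendsto (fun t => b (c * t) / b t) atTop (𝓝 (c ^ ρ))

/-- `P ∈ MRV(α, b, ν, ℝ₊ᴸ ∖ {0})`: `t · P(Z / b(t) ∈ ·) → ν` in `𝕄(ℝ₊ᴸ ∖ {0})`, where `Z ∼ P`,
`b ∈ RV_{1/α}`, and the limit measure `ν` is not the zero measure. -/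
structure MRV {L : ℕ} (P : Measure (Cone L)) (α : ℝ) (b : ℝ≥0 → ℝ≥0)
    (ν : Measure (Cone L)) : Prop where
  index_pos : 0 < α
  scaling : RegularlyVarying b (1 / α)
  limit_mem : IsMMeasure ν
  limit_ne_zero : ν ≠ 0
  tendsto : MTendsto (fun t : ℝ≥0 => t • P.map (fun z => (b t)⁻¹ • z)) atTop ν

/-- Connection functions `g` with `g(x) ∼ x` as `x ↓ 0` and at most linear growth. -/
structure IsConnectionFunction (g : ℝ≥0 → ℝ≥0) : Prop where
  measurable : Measurable g
  linear_bound : ∃ C : ℝ≥0, ∀ x, g x ≤ C * x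
  tendsto_zero : Tendsto (fun x => g x / x) (𝓝[>] 0) (𝓝 1)

section Model

variable {Ω : Type*} {L : ℕ}

/-- `T_l(N) = ∑_{i ≤ N} W_{il}`; nodes are numbered from `0`. -/
def totalWeight (W : ℕ → Ω → Cone L) (N : ℕ) (l : Fin L) (ω : Ω) : ℝ≥0 :=
  ∑ i : Fin N, W i ω l

/-- The conditional mean `g_l(W_{il} W_{jl} / T_l(N))` of the number of edges between `i` and `j`
in layer `l`. -/
noncomputable def edgeRate (g : Fin L → ℝ≥0 → ℝ≥0) (W : ℕ → Ω → Cone L) (N : ℕ)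
    (i j : Fin N) (l : Fin L) (ω : Ω) : ℝ≥0 :=
  g l (W i ω l * W j ω l / totalWeight W N l ω)

/-- The multilayer inhomogeneous random graphs on `N = 0, 1, 2, …` nodes with connection
functions `g`: the weight vectors `W i` are i.i.d., each adjacency tensor
`A N = (A_{ijl})` is symmetric in `i, j`, and, conditionally on `W_{[N]}`, the entries
`A_{ijl}`, `i ≤ j`, `l ∈ [L]`, are independent with
`A_{ijl} ∼ Poisson(g_l(W_{il} W_{jl} / T_l(N)))`. -/
structure IsMIRG [MeasurableSpace Ω] (μ : Measure Ω) (g : Fin L → ℝ≥0 → ℝ≥0)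
    (W : ℕ → Ω → Cone L) (A : (N : ℕ) → Fin N → Fin N → Fin L → Ω → ℕ) : Prop where
  measurable_connection : ∀ l, Measurable (g l)
  measurable_weight : ∀ i, Measurable (W i)
  measurable_adj : ∀ N i j l, Measurable (A N i j l)
  indep : iIndepFun W μ
  identDistrib : ∀ i, IdentDistrib (W i) (W 0) μ μ
  symm : ∀ N i j l ω, A N i j l ω = A N j i l ω
  cond_law : ∀ (N : ℕ) (k : Fin N → Fin N → Fin L → ℕ) (B : Set (Fin N → Cone L)),
    MeasurableSet B →
      μ ({ω | (fun i : Fin N => W i ω) ∈ B} ∩ {ω | ∀ i j l, i ≤ j → A N i j l ω = k i j l}) =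
        ∫⁻ ω in {ω | (fun i : Fin N => W i ω) ∈ B},
          ∏ i, ∏ j ∈ Finset.Ici i, ∏ l, poissonMeasure (edgeRate g W N i j l ω) {k i j l} ∂μ

/-- `D_{il}(N) = ∑_j A_{ijl}`. -/
def degree (A : (N : ℕ) → Fin N → Fin N → Fin L → Ω → ℕ) (N : ℕ) (i : Fin N) (l : Fin L)
    (ω : Ω) : ℕ :=
  ∑ j, A N i j l ω

/-- The generalized inverse `F⁻¹(p) = inf {x : F(x) ≥ p}`. -/
noncomputable def genInv (F : ℝ → ℝ) (p : ℝ) : ℝ :=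
  sInf {x | p ≤ F x}

/-- The empirical distribution function of the degrees in layer `l`. -/
noncomputable def empiricalCDF (A : (N : ℕ) → Fin N → Fin N → Fin L → Ω → ℕ) (N : ℕ)
    (l : Fin L) (ω : Ω) (x : ℝ) : ℝ :=
  (Finset.univ.filter fun i : Fin N => (degree A N i l ω : ℝ) ≤ x).card / (N : ℝ)

/-- The empirical `(1 - t_N / N)`-quantile of the degrees in layer `l`. -/
noncomputable def empiricalQuantile (A : (N : ℕ) → Fin N → Fin N → Fin L → Ω → ℕ) (t : ℕ → ℕ)
    (N : ℕ) (l : Fin L) (ω : Ω) : ℝ :=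
  genInv (empiricalCDF A N l ω) (1 - (t N : ℝ) / (N : ℝ))

/-- The empirical upper tail dependence estimator between layers `s` and `m`. -/
noncomputable def utdEstimator (A : (N : ℕ) → Fin N → Fin N → Fin L → Ω → ℕ) (t : ℕ → ℕ)
    (s m : Fin L) (N : ℕ) (ω : Ω) : ℝ :=
  ((Finset.univ.filter fun i : Fin N =>
      empiricalQuantile A t N s ω < (degree A N i s ω : ℝ) ∧
        empiricalQuantile A t N m ω < (degree A N i m ω : ℝ)).card : ℝ) /
    ((Finset.univ.filter fun i : Fin N =>
      empiricalQuantile A t N s ω < (degree A N i s ω : ℝ)).card : ℝ)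

end Model

/-- The quantile `F_l⁻¹(q)` of the `l`-th marginal of a distribution `P` on `ℝ₊ᴸ`. -/
noncomputable def marginalQuantile {L : ℕ} (P : Measure (Cone L)) (l : Fin L) (q : ℝ) : ℝ :=
  genInv (cdf (P.map fun w => (w l : ℝ))) q

/-- The upper tail dependence at level `q` between layers `s` and `m`:
`λ(q) = P(W_m > F_m⁻¹(q) | W_s > F_s⁻¹(q))`. -/
noncomputable def utd {L : ℕ} (P : Measure (Cone L)) (s m : Fin L) (q : ℝ) : ℝ :=
  (cond P {w | marginalQuantile P s q < (w s : ℝ)}).real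
    {w | marginalQuantile P m q < (w m : ℝ)}

/-- `lam` is the upper tail dependence coefficient `λ_U = lim_{q ↑ 1} λ(q)`. -/
def IsUTDCoefficient {L : ℕ} (P : Measure (Cone L)) (s m : Fin L) (lam : ℝ) : Prop :=
  Tendsto (utd P s m) (𝓝[<] 1) (𝓝 lam)

/-- An intermediate sequence of integers: `t_N → ∞` and `t_N / N → 0`
(so that `0 < t_N < N` for all large `N`). -/
structure IsIntermediate (t : ℕ → ℕ) : Prop where
  tendsto_atTop : Tendsto t atTop atTop
  tendsto_ratio : Tendsto (fun N => (t N : ℝ) / (N : ℝ)) atTop (𝓝 0)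

end MIRG

/-!
Among the `N` nodes about `t_N` have a weight `W_{il}` above the marginal quantile `a_N` at level
`1 - t_N / N`, and about `λ t_N` exceed the quantiles of both layers at once, by Chebyshev's
inequality for independent indicators. So it suffices that in each of the two layers the nodes with
`W_{il} > a_N` and those whose degree exceeds the empirical quantile agree up to `o(t_N)` nodes.

Given the weights, the degree of a node of weight `w` of order `a_N` is Poisson with mean
`∑_j g_l(w W_{jl} / T_l(N))`. As `g_l(x) ∼ x` at `0`, and at `∞` if the mean is infinite, the
term `j` is close to `w W_{jl} / T_l(N)` unless `W_{jl}` lies in a window that carries a negligible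
part of the total weight `T_l(N)`; hence the mean is close to `w`. The Poisson deviation
probabilities `e^{-κ a_N}` are `o(t_N / N)` because `P(W_l > a_N) ∼ t_N / N` decays only
polynomially in `a_N`.
Finally `o(t_N)` is all that is lost near the threshold, both when degrees replace weights and when
the empirical quantile replaces `a_N`, because the limiting tail counts `y^{-α}` are continuous.
-/

namespace MIRG

/-! ### Regularly varying tails -/

section Doubling

variable {φ : ℝ → ℝ} {q Y : ℝ}

lemma le_pow_mul_of_doubling (hq : 0 ≤ q) (hY : 0 ≤ Y) (hφ : ∀ y, Y ≤ y → φ (2 * y) ≤ q * φ y)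
    (k : ℕ) {y : ℝ} (hy : Y ≤ y) : φ (2 ^ k * y) ≤ q ^ k * φ y := by
  induction k with
  | zero => simp
  | succ k ih =>
    have hYk : Y ≤ 2 ^ k * y :=
      hy.trans (le_mul_of_one_le_left (hY.trans hy) (one_le_pow₀ one_le_two))
    calc φ (2 ^ (k + 1) * y) = φ (2 * (2 ^ k * y)) := by ring_nf
      _ ≤ q * φ (2 ^ k * y) := hφ _ hYk
      _ ≤ q * (q ^ k * φ y) := by gcongr
      _ = q ^ (k + 1) * φ y := by ring

lemma le_pow_mul_of_doubling_of_le {M : ℝ} (hq0 : 0 ≤ q) (hq1 : q ≤ 1) (hY : 0 < Y)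
    (hM0 : 0 ≤ M) (hM : ∀ y, Y ≤ y → y ≤ 2 * Y → φ y ≤ M)
    (hφ : ∀ y, Y ≤ y → φ (2 * y) ≤ q * φ y) (k : ℕ) {y : ℝ} (hy : 2 ^ k * Y ≤ y) :
    φ y ≤ q ^ k * M := by
  have hyY : 2 ^ k ≤ y / Y := (le_div_iff₀ hY).2 hy
  obtain ⟨j, hj, hj'⟩ :=
    exists_nat_pow_near ((one_le_pow₀ one_le_two).trans hyY) (one_lt_two (α := ℝ))
  have hkj : k ≤ j := by
    have := (pow_lt_pow_iff_right₀ (one_lt_two (α := ℝ))).1 (hyY.trans_lt hj')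
    omega
  rw [le_div_iff₀ hY] at hj
  rw [div_lt_iff₀ hY, pow_succ] at hj'
  have hz : Y ≤ y / 2 ^ j := by rwa [le_div_iff₀ (by positivity), mul_comm]
  have hz' : y / 2 ^ j ≤ 2 * Y := by rw [div_le_iff₀ (by positivity)]; linarith
  calc φ y = φ (2 ^ j * (y / 2 ^ j)) := by rw [mul_div_cancel₀ _ (by positivity)]
    _ ≤ q ^ j * φ (y / 2 ^ j) := le_pow_mul_of_doubling hq0 hY.le hφ j hz
    _ ≤ q ^ j * M := by gcongr; exact hM _ hz hz'
    _ ≤ q ^ k * M := by gcongr ?_ * M; exact pow_le_pow_of_le_one hq0 hq1 hkj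

lemma tendsto_zero_of_doubling {M : ℝ} (hq0 : 0 ≤ q) (hq1 : q < 1) (hY : 0 < Y)
    (h0 : ∀ y, Y ≤ y → 0 ≤ φ y) (hM : ∀ y, Y ≤ y → y ≤ 2 * Y → φ y ≤ M)
    (hφ : ∀ y, Y ≤ y → φ (2 * y) ≤ q * φ y) : Tendsto φ atTop (𝓝 0) := by
  have hM0 : 0 ≤ M := (h0 Y le_rfl).trans (hM Y le_rfl (by linarith))
  have hlim : Tendsto (fun k : ℕ => q ^ k * M) atTop (𝓝 0) := by
    simpa using (tendsto_pow_atTop_nhds_zero_of_lt_one hq0 hq1).mul_const M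
  rw [tendsto_order]
  refine ⟨fun e he => ?_, fun e he => ?_⟩
  · filter_upwards [eventually_ge_atTop Y] with y hy using he.trans_le (h0 y hy)
  · obtain ⟨k, hk⟩ := (hlim.eventually (gt_mem_nhds he)).exists
    filter_upwards [eventually_ge_atTop (2 ^ k * Y)] with y hy
    exact (le_pow_mul_of_doubling_of_le hq0 hq1.le hY hM0 hM hφ k hy).trans_lt hk

end Doubling

lemma tendsto_apply_of_antitone {ι : Type*} {l : Filter ι} {G : ι → ℝ → ℝ} {H : ℝ → ℝ}
    {u : ι → ℝ} {x : ℝ} (hG : ∀ᶠ i in l, Antitone (G i))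
    (hlim : ∀ᶠ z in 𝓝 x, Tendsto (fun i => G i z) l (𝓝 (H z))) (hH : ContinuousAt H x)
    (hu : Tendsto u l (𝓝 x)) : Tendsto (fun i => G i (u i)) l (𝓝 (H x)) := by
  rw [tendsto_order]
  refine ⟨fun e he => ?_, fun e he => ?_⟩
  · obtain ⟨z, ⟨hz, hzlim⟩, hxz⟩ := ((((hH.eventually (lt_mem_nhds he)).and hlim).filter_mono
      (nhdsWithin_le_nhds (s := Set.Ioi x))).and self_mem_nhdsWithin).exists
    filter_upwards [hG, hzlim.eventually (lt_mem_nhds hz), hu.eventually (gt_mem_nhds hxz)]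
      with i hanti hi hui
    exact hi.trans_le (hanti hui.le)
  · obtain ⟨z, ⟨hz, hzlim⟩, hzx⟩ := ((((hH.eventually (gt_mem_nhds he)).and hlim).filter_mono
      (nhdsWithin_le_nhds (s := Set.Iio x))).and self_mem_nhdsWithin).exists
    filter_upwards [hG, hzlim.eventually (gt_mem_nhds hz), hu.eventually (lt_mem_nhds hzx)]
      with i hanti hi hui
    exact (hanti hui.le).trans_lt hi

/-- `F` is a nonincreasing function with values in `[0, 1]`, regularly varying at infinity with
index `-α < 0`; this is what is required of the tail function `x ↦ P(X > x)` of a nonnegative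
random variable. Positivity is not a field: it follows from the limit of `F y / F y`, since
`0 / 0 = 0`. -/
structure RegularlyVaryingTail (F : ℝ → ℝ) (α : ℝ) : Prop where
  anti : Antitone F
  nonneg : ∀ x, 0 ≤ F x
  le_one : ∀ x, F x ≤ 1
  index_pos : 0 < α
  tendsto_ratio : ∀ x, 0 < x → Tendsto (fun y => F (x * y) / F y) atTop (𝓝 (x ^ (-α)))

namespace RegularlyVaryingTail

variable {F : ℝ → ℝ} {α : ℝ} {ι : Type*} {l : Filter ι}

lemma pos (h : RegularlyVaryingTail F α) (y : ℝ) : 0 < F y := by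
  have h1 := h.tendsto_ratio 1 one_pos
  rw [Real.one_rpow] at h1
  obtain ⟨z, hz, hyz⟩ := ((h1.eventually (lt_mem_nhds one_pos)).and (eventually_ge_atTop y)).exists
  have hFz : F z ≠ 0 := fun h0 => by simp [h0] at hz
  exact ((h.nonneg z).lt_of_ne' hFz).trans_le (h.anti hyz)

lemma exists_ratio_le (h : RegularlyVaryingTail F α) {q : ℝ} (hq : (2 : ℝ) ^ (-α) < q) :
    ∃ Y, 0 < Y ∧ ∀ y, Y ≤ y → F (2 * y) ≤ q * F y := by
  obtain ⟨Y, hY⟩ := eventually_atTop.1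
    ((h.tendsto_ratio 2 two_pos).eventually (gt_mem_nhds hq))
  refine ⟨max Y 1, by positivity, fun y hy => ?_⟩
  exact ((div_lt_iff₀ (h.pos y)).1 (hY y (le_of_max_le_left hy))).le

lemma exists_le_ratio (h : RegularlyVaryingTail F α) {q : ℝ} (hq : q < (2 : ℝ) ^ (-α)) :
    ∃ Y, 0 < Y ∧ ∀ y, Y ≤ y → q * F y ≤ F (2 * y) := by
  obtain ⟨Y, hY⟩ := eventually_atTop.1
    ((h.tendsto_ratio 2 two_pos).eventually (lt_mem_nhds hq))
  refine ⟨max Y 1, by positivity, fun y hy => ?_⟩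
  exact ((lt_div_iff₀ (h.pos y)).1 (hY y (le_of_max_le_left hy))).le

lemma two_rpow_neg_lt_one (h : RegularlyVaryingTail F α) : (2 : ℝ) ^ (-α) < 1 :=
  Real.rpow_lt_one_of_one_lt_of_neg one_lt_two (neg_lt_zero.2 h.index_pos)

lemma tendsto_exp_div (h : RegularlyVaryingTail F α) {κ : ℝ} (hκ : 0 < κ) :
    Tendsto (fun y => Real.exp (-κ * y) / F y) atTop (𝓝 0) := by
  set ρ : ℝ := (2 : ℝ) ^ (-α) / 2
  have hρ0 : 0 < ρ := by positivity
  obtain ⟨Y, hY, hF⟩ := h.exists_le_ratio (q := ρ) (half_lt_self (by positivity))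
  have hexp : Tendsto (fun y : ℝ => Real.exp (-κ * y)) atTop (𝓝 0) :=
    Real.tendsto_exp_atBot.comp (tendsto_id.const_mul_atTop_of_neg (neg_lt_zero.2 hκ))
  obtain ⟨Y', hY'⟩ := eventually_atTop.1 (hexp.eventually (gt_mem_nhds (half_pos hρ0)))
  set Z := max Y Y'
  have hZ0 : 0 < Z := lt_max_of_lt_left hY
  refine tendsto_zero_of_doubling (q := 1 / 2) (Y := Z) (M := 1 / F (2 * Z)) (by norm_num)
    (by norm_num) hZ0 (fun y _ => div_nonneg (Real.exp_pos _).le (h.nonneg y)) ?_ ?_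
  · intro y hy hy'
    have hle : Real.exp (-κ * y) ≤ 1 := Real.exp_le_one_iff.2 (by nlinarith)
    have := h.pos (2 * Z)
    gcongr
    exact h.anti hy'
  · intro y hy
    have hratio := hF y (le_of_max_le_left hy)
    have hsmall := (hY' y (le_of_max_le_right hy)).le
    have hp := h.pos y
    have hsq : Real.exp (-κ * (2 * y)) = Real.exp (-κ * y) * Real.exp (-κ * y) := by
      rw [← Real.exp_add]; ring_nf
    rw [div_le_iff₀ (h.pos _)]
    calc Real.exp (-κ * (2 * y)) ≤ Real.exp (-κ * y) * (ρ / 2) := by rw [hsq]; gcongr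
      _ = 1 / 2 * (Real.exp (-κ * y) / F y) * (ρ * F y) := by field_simp
      _ ≤ 1 / 2 * (Real.exp (-κ * y) / F y) * F (2 * y) := by gcongr

section OfScaling

variable {B : ℝ → ℝ} {c : ℝ}

lemma pos_of_tendsto_mul (anti : Antitone F) (hc : 0 < c) (scale : Tendsto B atTop atTop)
    (tail : Tendsto (fun n => n * F (B n)) atTop (𝓝 c)) (y : ℝ) : 0 < F y := by
  obtain ⟨n, hn, hB, hn0⟩ := ((tail.eventually (lt_mem_nhds hc)).and
    ((scale.eventually_ge_atTop y).and (eventually_gt_atTop 0))).exists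
  exact (pos_of_mul_pos_right hn hn0.le).trans_le (anti hB)

lemma tendsto_zero_of_tendsto_mul (anti : Antitone F) (nonneg : ∀ x, 0 ≤ F x)
    (tail : Tendsto (fun n => n * F (B n)) atTop (𝓝 c)) : Tendsto F atTop (𝓝 0) := by
  have hdiv : Tendsto (fun n => n * F (B n) / n) atTop (𝓝 0) := tail.div_atTop tendsto_id
  rw [tendsto_order]
  refine ⟨fun e he => Eventually.of_forall fun y => he.trans_le (nonneg y), fun e he => ?_⟩
  obtain ⟨n, hn, hn0⟩ := ((hdiv.eventually (gt_mem_nhds he)).and (eventually_gt_atTop 0)).exists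
  rw [mul_div_cancel_left₀ _ hn0.ne'] at hn
  filter_upwards [eventually_ge_atTop (B n)] with y hy using (anti hy).trans_lt hn

lemma mul_mul_rpow_inv_rpow_neg {x : ℝ} (hc : 0 < c) (hα : 0 < α) (hx : 0 ≤ x) :
    c * (x * c ^ (1 / α)) ^ (-α) = x ^ (-α) := by
  have hexp : 1 / α * -α = -1 := by field_simp
  rw [Real.mul_rpow hx (by positivity), ← Real.rpow_mul hc.le, hexp, Real.rpow_neg_one]
  field_simp

lemma tendsto_div_of_tendsto_mul (anti : Antitone F) (pos : ∀ y, 0 < F y) (hc : 0 < c)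
    (hα : 0 < α) (zero : Tendsto F atTop (𝓝 0)) (scale : Tendsto B atTop atTop)
    (tail : ∀ x, 0 < x → Tendsto (fun n => n * F (x * B n)) atTop (𝓝 (c * x ^ (-α)))) :
    Tendsto (fun y => y / B (F y)⁻¹) atTop (𝓝 (c ^ (1 / α))) := by
  have hn : Tendsto (fun y => (F y)⁻¹) atTop atTop :=
    tendsto_inv_nhdsGT_zero.comp (tendsto_nhdsWithin_iff.2 ⟨zero, Eventually.of_forall pos⟩)
  have hB : ∀ᶠ y in atTop, 0 < B (F y)⁻¹ := (scale.comp hn).eventually_gt_atTop 0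
  have hθ : 0 < c ^ (1 / α) := by positivity
  have hθ1 : c * (c ^ (1 / α)) ^ (-α) = 1 := by
    simpa using mul_mul_rpow_inv_rpow_neg hc hα zero_le_one
  rw [tendsto_order]
  refine ⟨fun e he => ?_, fun e he => ?_⟩
  · obtain ⟨z, hze, hzθ⟩ := exists_between (max_lt he hθ)
    have hz : 0 < z := (le_max_right _ _).trans_lt hze
    have hlim : 1 < c * z ^ (-α) := by
      rw [← hθ1]
      exact mul_lt_mul_of_pos_left (Real.rpow_lt_rpow_of_neg hz hzθ (neg_lt_zero.2 hα)) hc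
    filter_upwards [((tail z hz).comp hn).eventually (lt_mem_nhds hlim), hB] with y hy hBy
    rw [Function.comp_apply, inv_mul_eq_div, one_lt_div (pos y)] at hy
    exact ((le_max_left _ _).trans hze.le).trans_lt
      ((lt_div_iff₀ hBy).2 (anti.reflect_lt hy))
  · have hlim : c * e ^ (-α) < 1 := by
      rw [← hθ1]
      exact mul_lt_mul_of_pos_left (Real.rpow_lt_rpow_of_neg hθ he (neg_lt_zero.2 hα)) hc
    filter_upwards [((tail e (hθ.trans he)).comp hn).eventually (gt_mem_nhds hlim), hB]
      with y hy hBy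
    rw [Function.comp_apply, inv_mul_eq_div, div_lt_one (pos y)] at hy
    exact (div_lt_iff₀ hBy).2 (anti.reflect_lt hy)

theorem of_tendsto_mul (anti : Antitone F) (nonneg : ∀ x, 0 ≤ F x) (le_one : ∀ x, F x ≤ 1)
    (hc : 0 < c) (hα : 0 < α) (scale : Tendsto B atTop atTop)
    (tail : ∀ x, 0 < x → Tendsto (fun n => n * F (x * B n)) atTop (𝓝 (c * x ^ (-α)))) :
    RegularlyVaryingTail F α := by
  have tail_one : Tendsto (fun n => n * F (B n)) atTop (𝓝 c) := by simpa using tail 1 one_pos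
  have pos := pos_of_tendsto_mul anti hc scale tail_one
  have zero := tendsto_zero_of_tendsto_mul anti nonneg tail_one
  have hn : Tendsto (fun y => (F y)⁻¹) atTop atTop :=
    tendsto_inv_nhdsGT_zero.comp (tendsto_nhdsWithin_iff.2 ⟨zero, Eventually.of_forall pos⟩)
  have hB : ∀ᶠ y in atTop, 0 < B (F y)⁻¹ := (scale.comp hn).eventually_gt_atTop 0
  refine ⟨anti, nonneg, le_one, hα, fun x hx => ?_⟩
  have hxθ : 0 < x * c ^ (1 / α) := by positivity
  have hlim := tendsto_apply_of_antitone (l := atTop)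
    (G := fun y z => (F y)⁻¹ * F (z * B (F y)⁻¹)) (H := fun z => c * z ^ (-α)) ?_ ?_ ?_
    ((tendsto_div_of_tendsto_mul anti pos hc hα zero scale tail).const_mul x)
  · rw [mul_mul_rpow_inv_rpow_neg hc hα hx.le] at hlim
    refine hlim.congr' ?_
    filter_upwards [hB] with y hBy
    rw [mul_assoc, div_mul_cancel₀ _ hBy.ne', inv_mul_eq_div]
  · filter_upwards [hB] with y hBy z z' hz
    have := pos y
    exact mul_le_mul_of_nonneg_left (anti (by gcongr)) (by positivity)
  · filter_upwards [lt_mem_nhds hxθ] with z hz using (tail z hz).comp hn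
  · exact continuousAt_const.mul (Real.continuousAt_rpow_const _ _ (Or.inl hxθ.ne'))

end OfScaling

section Inversion

variable {n y : ι → ℝ}

lemma tendsto_atTop_of_mul_le (h : RegularlyVaryingTail F α) (hn : Tendsto n l atTop)
    (hle : ∀ᶠ i in l, n i * F (y i) ≤ 1) : Tendsto y l atTop := by
  refine tendsto_atTop.2 fun M => ?_
  filter_upwards [hle, hn.eventually_gt_atTop (F M)⁻¹] with i hi hni
  by_contra! hlt
  have hM : 1 < n i * F M := by rwa [inv_lt_iff_one_lt_mul₀ (h.pos M)] at hni
  have hn0 : 0 ≤ n i := (inv_nonneg.2 (h.nonneg M)).trans hni.le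
  linarith [mul_le_mul_of_nonneg_left (h.anti hlt.le) hn0]

/-- The tail at a point of the generalized inverse of `1 / F` jumps by a factor that tends to
`1`, because `F (r y) / F y → r^{-α}` is close to `1` for `r` close to `1`. -/
theorem tendsto_mul_of_inversion (h : RegularlyVaryingTail F α) (hn : Tendsto n l atTop)
    (hle : ∀ᶠ i in l, n i * F (y i) ≤ 1) (hge : ∀ᶠ i in l, ∀ z < y i, 1 ≤ n i * F z) :
    Tendsto (fun i => n i * F (y i)) l (𝓝 1) := by
  have hy := h.tendsto_atTop_of_mul_le hn hle
  rw [tendsto_order]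
  refine ⟨fun e he => ?_, fun e he => hle.mono fun i hi => hi.trans_lt he⟩
  have hcont : Tendsto (fun r : ℝ => e * r ^ (-α)) (𝓝[<] 1) (𝓝 e) := by
    have := (Real.continuousAt_rpow_const 1 (-α) (Or.inl one_ne_zero)).tendsto.const_mul e
    rw [Real.one_rpow, mul_one] at this
    exact this.mono_left nhdsWithin_le_nhds
  obtain ⟨r, ⟨hr, hr0⟩, hr1 : r < 1⟩ := (((hcont.eventually (gt_mem_nhds he)).and
    ((lt_mem_nhds one_pos).filter_mono nhdsWithin_le_nhds)).and self_mem_nhdsWithin).exists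
  have hratio := ((h.tendsto_ratio r hr0).comp hy).const_mul e
  filter_upwards [hge, hratio.eventually (gt_mem_nhds hr), hy.eventually_gt_atTop 0,
    hn.eventually_gt_atTop 0] with i hi hri hyi hni
  have hone := hi (r * y i) (mul_lt_of_lt_one_left hyi hr1)
  rw [Function.comp_apply, mul_div_assoc', div_lt_one (h.pos _)] at hri
  rcases lt_or_ge e 0 with he0 | he0
  · exact he0.trans_le (mul_nonneg hni.le (h.nonneg _))
  · calc e ≤ e * (n i * F (r * y i)) := le_mul_of_one_le_right he0 hone
      _ = n i * (e * F (r * y i)) := by ring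
      _ < n i * F (y i) := by gcongr

end Inversion

/-! ### Truncated means -/

/-- The truncated mean `E[X ∧ y] = ∫₀^y P(X > u) du`, written in terms of the tail function `F`
of the nonnegative random variable `X`. -/
noncomputable def truncatedMean (F : ℝ → ℝ) (y : ℝ) : ℝ := ∫ u in (0 : ℝ)..y, F u

lemma truncatedMean_sub (anti : Antitone F) (x y : ℝ) :
    truncatedMean F y - truncatedMean F x = ∫ u in x..y, F u :=
  intervalIntegral.integral_interval_sub_left anti.intervalIntegrable anti.intervalIntegrable

lemma truncatedMean_sub_le (anti : Antitone F) {x y : ℝ} (hxy : x ≤ y) :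
    truncatedMean F y - truncatedMean F x ≤ (y - x) * F x := by
  rw [truncatedMean_sub anti]
  calc ∫ u in x..y, F u ≤ ∫ _ in x..y, F x :=
        intervalIntegral.integral_mono_on hxy anti.intervalIntegrable (by simp)
          fun u hu => anti hu.1
    _ = (y - x) * F x := by simp

lemma le_truncatedMean_sub (anti : Antitone F) {x y : ℝ} (hxy : x ≤ y) :
    (y - x) * F y ≤ truncatedMean F y - truncatedMean F x := by
  rw [truncatedMean_sub anti]
  calc (y - x) * F y = ∫ _ in x..y, F y := by simp
    _ ≤ ∫ u in x..y, F u :=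
        intervalIntegral.integral_mono_on hxy (by simp) anti.intervalIntegrable
          fun u hu => anti hu.2

lemma continuous_truncatedMean (anti : Antitone F) : Continuous (truncatedMean F) :=
  intervalIntegral.continuous_primitive (fun _ _ => anti.intervalIntegrable) 0

lemma truncatedMean_zero : truncatedMean F 0 = 0 := intervalIntegral.integral_same

lemma monotone_truncatedMean (h : RegularlyVaryingTail F α) : Monotone (truncatedMean F) :=
  fun _ y hxy => sub_nonneg.1 <|
    (mul_nonneg (sub_nonneg.2 hxy) (h.nonneg y)).trans (le_truncatedMean_sub h.anti hxy)

lemma truncatedMean_nonneg (h : RegularlyVaryingTail F α) {y : ℝ} (hy : 0 ≤ y) :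
    0 ≤ truncatedMean F y :=
  truncatedMean_zero.symm.trans_le (h.monotone_truncatedMean hy)

lemma truncatedMean_pos (h : RegularlyVaryingTail F α) {y : ℝ} (hy : 0 < y) :
    0 < truncatedMean F y := by
  have hle := le_truncatedMean_sub h.anti hy.le
  rw [truncatedMean_zero, sub_zero, sub_zero] at hle
  exact (mul_pos hy (h.pos y)).trans_le hle

lemma truncatedMean_two_mul_le (h : RegularlyVaryingTail F α) {q : ℝ}
    (hq : (2 : ℝ) ^ (-α) < q) :
    ∃ Y, 0 < Y ∧ ∀ y, Y ≤ y →
      truncatedMean F (2 * y) ≤ 2 * Y + 2 * q * truncatedMean F y := by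
  have hq0 : 0 < q := lt_trans (by positivity) hq
  obtain ⟨Y, hY, hF⟩ := h.exists_ratio_le hq
  refine ⟨Y, hY, fun y hy => ?_⟩
  have hinit : truncatedMean F (2 * Y) ≤ 2 * Y := by
    have := truncatedMean_sub_le h.anti (x := 0) (y := 2 * Y) (by linarith)
    rw [truncatedMean_zero] at this
    nlinarith [h.le_one 0]
  have hscale : truncatedMean F (2 * y) - truncatedMean F (2 * Y) =
      2 * ∫ u in Y..y, F (2 * u) := by
    rw [truncatedMean_sub h.anti, intervalIntegral.integral_comp_mul_left _ two_ne_zero]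
    simp
  have hanti : Antitone fun u => F (2 * u) := fun u v huv => h.anti (by linarith)
  have hratio : ∫ u in Y..y, F (2 * u) ≤ ∫ u in Y..y, q * F u :=
    intervalIntegral.integral_mono_on hy hanti.intervalIntegrable
      (h.anti.intervalIntegrable.const_mul q) fun u hu => hF u hu.1
  rw [intervalIntegral.integral_const_mul, ← truncatedMean_sub h.anti] at hratio
  nlinarith [h.truncatedMean_nonneg hY.le]

lemma truncatedMean_tendsto_atTop_or (h : RegularlyVaryingTail F α) :
    Tendsto (truncatedMean F) atTop atTop ∨
      ∃ M, 0 < M ∧ Tendsto (truncatedMean F) atTop (𝓝 M) := by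
  rcases tendsto_atTop_of_monotone h.monotone_truncatedMean with hinf | ⟨M, hM⟩
  · exact Or.inl hinf
  · exact Or.inr ⟨M, (h.truncatedMean_pos one_pos).trans_le
      (h.monotone_truncatedMean.ge_of_tendsto hM 1), hM⟩

lemma truncatedMean_doubling (h : RegularlyVaryingTail F α) :
    ∃ r Y, 1 ≤ r ∧ r < 2 ∧ 0 < Y ∧
      ∀ y, Y ≤ y → truncatedMean F (2 * y) ≤ r * truncatedMean F y := by
  rcases h.truncatedMean_tendsto_atTop_or with hinf | ⟨M, hM0, hM⟩
  · obtain ⟨q, hq, hq1⟩ := exists_between h.two_rpow_neg_lt_one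
    have hq0 : 0 < q := lt_trans (by positivity) hq
    obtain ⟨Y, hY, hF⟩ := h.truncatedMean_two_mul_le hq
    obtain ⟨Z, hZ⟩ := eventually_atTop.1 (hinf.eventually_ge_atTop (2 * Y / (1 - q)))
    refine ⟨1 + q, max Y Z, by linarith, by linarith, lt_max_of_lt_left hY, fun y hy => ?_⟩
    have hdouble := hF y (le_of_max_le_left hy)
    have hlarge := hZ y (le_of_max_le_right hy)
    rw [div_le_iff₀ (by linarith)] at hlarge
    linarith
  · obtain ⟨Z, hZ⟩ := eventually_atTop.1
      (hM.eventually (lt_mem_nhds (show M / (3 / 2) < M from div_lt_self hM0 (by norm_num))))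
    refine ⟨3 / 2, max 1 Z, by norm_num, by norm_num, lt_max_of_lt_left one_pos,
      fun y hy => ?_⟩
    have hclose := hZ y (le_of_max_le_right hy)
    rw [div_lt_iff₀ (by norm_num)] at hclose
    linarith [h.monotone_truncatedMean.ge_of_tendsto hM (2 * y)]

lemma truncatedMean_div_tendsto_zero (h : RegularlyVaryingTail F α) :
    Tendsto (fun y => truncatedMean F y / y) atTop (𝓝 0) := by
  obtain ⟨r, Y, hr1, hr2, hY, hd⟩ := h.truncatedMean_doubling
  refine tendsto_zero_of_doubling (q := r / 2) (Y := Y) (M := truncatedMean F (2 * Y) / Y)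
    (by linarith) (by linarith) hY
    (fun y hy => div_nonneg (h.truncatedMean_nonneg (by linarith)) (by linarith)) ?_ ?_
  · intro y hy hy'
    have := h.truncatedMean_nonneg (y := 2 * Y) (by linarith)
    gcongr
    exact h.monotone_truncatedMean hy'
  · intro y hy
    have hy0 : 0 < y := hY.trans_le hy
    rw [div_le_iff₀ (by positivity)]
    calc truncatedMean F (2 * y) ≤ r * truncatedMean F y := hd y hy
      _ = r / 2 * (truncatedMean F y / y) * (2 * y) := by field_simp

lemma mul_tendsto_zero (h : RegularlyVaryingTail F α) {M : ℝ}
    (hM : Tendsto (truncatedMean F) atTop (𝓝 M)) : Tendsto (fun y => y * F y) atTop (𝓝 0) := by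
  have hinc : Tendsto (fun y : ℝ => 2 * (truncatedMean F y - truncatedMean F (y / 2))) atTop
      (𝓝 0) := by
    simpa using (hM.sub (hM.comp (tendsto_id.atTop_div_const two_pos))).const_mul 2
  refine squeeze_zero' ?_ ?_ hinc
  · filter_upwards [eventually_ge_atTop 0] with y hy using mul_nonneg hy (h.nonneg y)
  · filter_upwards [eventually_ge_atTop 0] with y hy
    linarith [le_truncatedMean_sub h.anti (half_le_self hy)]

lemma half_le_two_rpow_neg (h : RegularlyVaryingTail F α)
    (hm : Tendsto (truncatedMean F) atTop atTop) : 1 / 2 ≤ (2 : ℝ) ^ (-α) := by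
  by_contra! hlt
  obtain ⟨q, hq, hq'⟩ := exists_between hlt
  obtain ⟨Y, -, hF⟩ := h.truncatedMean_two_mul_le hq
  obtain ⟨y, hy, hYy⟩ := ((hm.eventually_gt_atTop (2 * Y / (1 - 2 * q))).and
    (eventually_ge_atTop (max Y 0))).exists
  have hdouble := hF y (le_of_max_le_left hYy)
  have hmono := h.monotone_truncatedMean
    (le_mul_of_one_le_left (le_of_max_le_right hYy) one_le_two)
  rw [div_lt_iff₀ (by linarith)] at hy
  linarith

lemma nat_mul_le_truncatedMean (h : RegularlyVaryingTail F α) {d Y y : ℝ} (hd0 : 0 < d)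
    (hd1 : d ≤ 1) (hF : ∀ z, Y ≤ z → d / 2 * F z ≤ F (2 * z)) (hY : 0 ≤ Y) (hYy : Y ≤ y)
    {k i : ℕ} (hik : i ≤ k) :
    i * (d ^ k / 2 * (y * F y)) ≤ truncatedMean F (2 ^ i * y) := by
  have hy : 0 ≤ y := hY.trans hYy
  induction i with
  | zero => simpa using h.truncatedMean_nonneg hy
  | succ i ih =>
    have hstep : d ^ k / 2 * (y * F y) ≤
        truncatedMean F (2 ^ (i + 1) * y) - truncatedMean F (2 ^ i * y) := by
      have hiter : (d / 2) ^ (i + 1) * F y ≤ F (2 ^ (i + 1) * y) := by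
        have := le_pow_mul_of_doubling (φ := fun z => -F z) (q := d / 2) (by positivity) hY
          (fun z hz => by linarith [hF z hz]) (i + 1) hYy
        linarith
      have hdk : d ^ k ≤ d ^ (i + 1) := pow_le_pow_of_le_one hd0.le hd1 hik
      have hF0 := h.nonneg y
      calc d ^ k / 2 * (y * F y) ≤ d ^ (i + 1) / 2 * (y * F y) := by gcongr
        _ = 2 ^ i * y * ((d / 2) ^ (i + 1) * F y) := by rw [div_pow]; field_simp; ring
        _ ≤ 2 ^ i * y * F (2 ^ (i + 1) * y) := by gcongr
        _ = (2 ^ (i + 1) * y - 2 ^ i * y) * F (2 ^ (i + 1) * y) := by ring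
        _ ≤ _ := le_truncatedMean_sub h.anti (by gcongr <;> norm_num)
    push_cast
    linarith [ih (by omega)]

/-- If the mean is infinite, each of the dyadic blocks `[2 ^ i y, 2 ^ (i + 1) y]`, `i < k`, of
the truncated mean contributes at least about `y F y / 2`; take `k > 4 / ε`. -/
lemma exists_mul_le_truncatedMean (h : RegularlyVaryingTail F α)
    (hm : Tendsto (truncatedMean F) atTop atTop) {ε : ℝ} (hε : 0 < ε) :
    ∃ K Y, ∀ τ y, Y ≤ τ → 0 ≤ y → K * y ≤ τ → y * F y ≤ ε * truncatedMean F τ := by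
  obtain ⟨k, hk⟩ := exists_nat_gt (4 / ε)
  have hpow : Tendsto (fun d : ℝ => d ^ k) (𝓝 1) (𝓝 1) := by
    simpa using (continuous_pow k).tendsto (1 : ℝ)
  have hhalf : (1 / 2 : ℝ) < 1 := by norm_num
  obtain ⟨d, ⟨hdk, hd0⟩, hd1 : d < 1⟩ := ((((hpow.eventually (lt_mem_nhds hhalf)).and
    (lt_mem_nhds one_pos)).filter_mono
      (nhdsWithin_le_nhds (s := Set.Iio 1))).and self_mem_nhdsWithin).exists
  obtain ⟨Y, hY, hF⟩ := h.exists_le_ratio (q := d / 2) (by linarith [h.half_le_two_rpow_neg hm])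
  obtain ⟨Z, hZ⟩ := eventually_atTop.1 (hm.eventually_ge_atTop (Y / ε))
  refine ⟨2 ^ k, Z, fun τ y hτ hy hyτ => ?_⟩
  rcases le_total y Y with hyY | hYy
  · have hlarge := hZ τ hτ
    rw [div_le_iff₀ hε] at hlarge
    calc y * F y ≤ Y * 1 := mul_le_mul hyY (h.le_one y) (h.nonneg y) hY.le
      _ ≤ ε * truncatedMean F τ := by linarith
  · rw [div_lt_iff₀ hε] at hk
    have hyF : 0 ≤ y * F y := mul_nonneg hy (h.nonneg y)
    calc y * F y ≤ ε * (k * (d ^ k / 2 * (y * F y))) := by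
          have : 1 ≤ k * ε * (d ^ k / 2) := by nlinarith
          nlinarith
      _ ≤ ε * truncatedMean F τ := by
          gcongr
          exact (h.nat_mul_le_truncatedMean hd0 hd1.le hF hY.le hYy le_rfl).trans
            (h.monotone_truncatedMean hyτ)

end RegularlyVaryingTail

/-! ### Marginal tails of multivariate regularly varying distributions -/

section Marginal

variable {L : ℕ} {P ν : Measure (Cone L)} {α : ℝ} {b : ℝ≥0 → ℝ≥0}

lemma measurableSet_lt_coord (l : Fin L) (x : ℝ≥0) : MeasurableSet {w : Cone L | x < w l} :=
  measurableSet_lt measurable_const (measurable_pi_apply l)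

lemma measurableSet_le_coord (l : Fin L) (x : ℝ≥0) : MeasurableSet {w : Cone L | x ≤ w l} :=
  measurableSet_le measurable_const (measurable_pi_apply l)

lemma coord_le_dist_zero (l : Fin L) (w : Cone L) : (w l : ℝ) ≤ dist w 0 := by
  simpa [NNReal.dist_eq] using dist_le_pi_dist w 0 l

lemma exists_continuous_between_indicators (l : Fin L) {x y : ℝ≥0} (hx : 0 < x) (hxy : x < y) :
    ∃ f : Cone L →ᵇ ℝ≥0, (∃ ε : ℝ, 0 < ε ∧ ∀ w, dist w 0 < ε → f w = 0) ∧
      (∀ w, {w : Cone L | y ≤ w l}.indicator 1 w ≤ (f w : ℝ≥0∞)) ∧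
      ∀ w, (f w : ℝ≥0∞) ≤ {w : Cone L | x < w l}.indicator 1 w := by
  have hδ : (0 : ℝ) < y - x := sub_pos.2 (by exact_mod_cast hxy)
  set f := thickenedIndicator hδ {w : Cone L | y ≤ w l} with hf
  have hzero : ∀ w : Cone L, w l ≤ x → f w = 0 := by
    intro w hw
    refine thickenedIndicator_zero hδ _ fun hmem => ?_
    obtain ⟨v, hv : y ≤ v l, hdist⟩ := Metric.mem_thickening_iff.1 hmem
    have hcoord := (dist_le_pi_dist w v l).trans_lt hdist
    rw [NNReal.dist_eq, abs_lt] at hcoord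
    have hv' : (y : ℝ) ≤ v l := by exact_mod_cast hv
    have hw' : (w l : ℝ) ≤ x := by exact_mod_cast hw
    linarith
  refine ⟨f, ⟨x, by exact_mod_cast hx, fun w hw => hzero w ?_⟩, fun w => ?_, fun w => ?_⟩
  · exact_mod_cast (coord_le_dist_zero l w).trans hw.le
  · by_cases hw : y ≤ w l
    · rw [hf, thickenedIndicator_one hδ _ (show w ∈ {w : Cone L | y ≤ w l} from hw)]
      exact Set.indicator_le_self' (by simp) w
    · simp [hw]
  · by_cases hw : x < w l
    · rw [Set.indicator_of_mem (show w ∈ {w : Cone L | x < w l} from hw), Pi.one_apply]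
      exact ENNReal.coe_le_one_iff.2 (thickenedIndicator_le_one hδ {w : Cone L | y ≤ w l} w)
    · simp [hzero w (not_lt.1 hw)]

/-- The scaled tail `t P(W_l > x b(t))` of the `l`-th coordinate of `W ∼ P`. -/
noncomputable def scaledTail (P : Measure (Cone L)) (b : ℝ≥0 → ℝ≥0) (l : Fin L)
    (t x : ℝ≥0) : ℝ≥0∞ :=
  t * P {w | x * b t < w l}

lemma smul_map_apply_eq_scaledTail (l : Fin L) {t : ℝ≥0} (ht : 0 < b t) (x : ℝ≥0) :
    (t • P.map fun z => (b t)⁻¹ • z) {w | x < w l} = scaledTail P b l t x := by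
  have hpre : (fun z : Cone L => (b t)⁻¹ • z) ⁻¹' {w | x < w l} = {w | x * b t < w l} := by
    ext w
    simp only [Set.mem_preimage, Set.mem_ofPred_eq, Pi.smul_apply, smul_eq_mul]
    rw [inv_mul_eq_div, lt_div_iff₀ ht]
  rw [Measure.smul_apply, Measure.map_apply (by fun_prop) (measurableSet_lt_coord l x), hpre]
  rfl

lemma scaledTail_mul_le {l : Fin L} {c t x y : ℝ≥0} (hxy : y * b t ≤ x * b (c * t)) :
    scaledTail P b l (c * t) x ≤ c * scaledTail P b l t y := by
  unfold scaledTail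
  rw [← mul_assoc, ← ENNReal.coe_mul]
  gcongr with w

namespace MRV

lemma eventually_scaledTail_lt (h : MRV P α b ν) (l : Fin L) {x y : ℝ≥0} (hx : 0 < x)
    (hxy : x < y) {e : ℝ≥0∞} (he : ν {w | x ≤ w l} < e) :
    ∀ᶠ t in atTop, scaledTail P b l t y < e := by
  obtain ⟨f, hf0, hle, hge⟩ := exists_continuous_between_indicators l hx hxy
  have hfν : ∫⁻ w, (f w : ℝ≥0∞) ∂ν < e := by
    refine lt_of_le_of_lt ?_ he
    calc ∫⁻ w, (f w : ℝ≥0∞) ∂ν ≤ ∫⁻ w, {w : Cone L | x < w l}.indicator 1 w ∂ν :=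
          lintegral_mono hge
      _ = ν {w | x < w l} := lintegral_indicator_one (measurableSet_lt_coord l x)
      _ ≤ ν {w | x ≤ w l} := measure_mono fun w (hw : x < w l) => hw.le
  filter_upwards [(h.tendsto f hf0).eventually (gt_mem_nhds hfν), h.scaling.eventually_pos]
    with t ht hb
  refine lt_of_le_of_lt ?_ ht
  calc scaledTail P b l t y = (t • P.map fun z => (b t)⁻¹ • z) {w | y < w l} :=
        (smul_map_apply_eq_scaledTail l hb y).symm
    _ ≤ (t • P.map fun z => (b t)⁻¹ • z) {w | y ≤ w l} :=
        measure_mono fun w (hw : y < w l) => hw.le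
    _ = _ := (lintegral_indicator_one (measurableSet_le_coord l y)).symm
    _ ≤ _ := lintegral_mono hle

lemma eventually_lt_scaledTail (h : MRV P α b ν) (l : Fin L) {x y : ℝ≥0} (hx : 0 < x)
    (hxy : x < y) {e : ℝ≥0∞} (he : e < ν {w | y ≤ w l}) :
    ∀ᶠ t in atTop, e < scaledTail P b l t x := by
  obtain ⟨f, hf0, hle, hge⟩ := exists_continuous_between_indicators l hx hxy
  have hfν : e < ∫⁻ w, (f w : ℝ≥0∞) ∂ν := by
    refine lt_of_lt_of_le he ?_
    rw [← lintegral_indicator_one (measurableSet_le_coord l y)]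
    exact lintegral_mono hle
  filter_upwards [(h.tendsto f hf0).eventually (lt_mem_nhds hfν), h.scaling.eventually_pos]
    with t ht hb
  refine lt_of_lt_of_le ht ?_
  rw [← smul_map_apply_eq_scaledTail l hb, ← lintegral_indicator_one (measurableSet_lt_coord l x)]
  exact lintegral_mono hge

lemma coord_ne_top (h : MRV P α b ν) (l : Fin L) {x : ℝ≥0} (hx : 0 < x) :
    ν {w | x ≤ w l} ≠ ∞ := by
  refine ne_top_of_le_ne_top (h.limit_mem.finite_away x (by exact_mod_cast hx)).ne
    (measure_mono fun w (hw : x ≤ w l) => ?_)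
  exact (NNReal.coe_le_coe.2 hw).trans (coord_le_dist_zero l w)

lemma coord_le_mul_of_lt (h : MRV P α b ν) (l : Fin L) {c x z : ℝ≥0} (hc : 0 < c) (hz : 0 < z)
    (hzx : z < c ^ (1 / α) * x) : ν {w | x ≤ w l} ≤ c * ν {w | z ≤ w l} := by
  have hκ : 0 < c ^ (1 / α) := NNReal.rpow_pos hc
  by_contra! hcon
  obtain ⟨e, he, hex⟩ := exists_between hcon
  have hez : ν {w | z ≤ w l} < e / c := by
    rwa [ENNReal.lt_div_iff_mul_lt (Or.inl (by exact_mod_cast hc.ne'))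
      (Or.inl ENNReal.coe_ne_top), mul_comm]
  obtain ⟨z₁, hz₁, hz₁x⟩ := exists_between hzx
  obtain ⟨z₂, hz₂, hz₂x⟩ := exists_between hz₁x
  have hz₂0 : 0 < z₂ := hz.trans (hz₁.trans hz₂)
  have hlower := (tendsto_id.const_mul_atTop hc).eventually
    (h.eventually_lt_scaledTail l (div_pos hz₂0 hκ) ((div_lt_iff₀' hκ).2 hz₂x) hex)
  have hratio : c ^ (1 / α) * (z₁ / z₂) < c ^ (1 / α) :=
    mul_lt_of_lt_one_right hκ ((div_lt_one hz₂0).2 hz₂)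
  obtain ⟨t, ⟨⟨hlow, hup⟩, hb⟩, hbt⟩ := (((hlower.and
    (h.eventually_scaledTail_lt l hz hz₁ hez)).and
    ((h.scaling.tendsto_ratio c hc).eventually (lt_mem_nhds hratio))).and
    h.scaling.eventually_pos).exists
  have hthreshold : z₁ * b t ≤ z₂ / c ^ (1 / α) * b (c * t) := by
    rw [lt_div_iff₀ hbt] at hb
    calc z₁ * b t = z₂ / c ^ (1 / α) * (c ^ (1 / α) * (z₁ / z₂) * b t) := by field_simp
      _ ≤ _ := by gcongr
  refine absurd hlow (not_lt.2 ?_)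
  calc scaledTail P b l (c * t) (z₂ / c ^ (1 / α)) ≤ c * scaledTail P b l t z₁ :=
        scaledTail_mul_le hthreshold
    _ ≤ c * (e / c) := by gcongr
    _ ≤ e := ENNReal.mul_div_le

lemma coord_le_mul (h : MRV P α b ν) (l : Fin L) {c x : ℝ≥0} (hc : 0 < c) (hx : 0 < x) :
    ν {w | x ≤ w l} ≤ c * ν {w | c ^ (1 / α) * x ≤ w l} := by
  obtain ⟨u, hu, hu_mem, hu_lim⟩ := exists_seq_strictMono_tendsto' (mul_pos (NNReal.rpow_pos hc) hx)
  have hset : ⋂ k, {w : Cone L | u k ≤ w l} = {w | c ^ (1 / α) * x ≤ w l} := by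
    ext w
    simp only [Set.mem_iInter, Set.mem_ofPred_eq]
    exact ⟨fun hw => le_of_tendsto' hu_lim hw, fun hw k => (hu_mem k).2.le.trans hw⟩
  have hlim : Tendsto (fun k => ν {w : Cone L | u k ≤ w l}) atTop
      (𝓝 (ν {w | c ^ (1 / α) * x ≤ w l})) := by
    rw [← hset]
    exact tendsto_measure_iInter_atTop
      (fun k => (measurableSet_le_coord l (u k)).nullMeasurableSet)
      (fun i j hij w hw => (hu.monotone hij).trans hw) ⟨0, h.coord_ne_top l (hu_mem 0).1⟩
  exact ge_of_tendsto' (ENNReal.Tendsto.const_mul hlim (Or.inr ENNReal.coe_ne_top))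
    fun k => h.coord_le_mul_of_lt l hc (hu_mem k).1 (hu_mem k).2

lemma coord_eq_mul_rpow (h : MRV P α b ν) (l : Fin L) {x : ℝ≥0} (hx : 0 < x) :
    ν {w | x ≤ w l} = ν {w | 1 ≤ w l} * (x ^ (-α) : ℝ≥0) := by
  have hα := h.index_pos.ne'
  have hroot : ∀ z : ℝ≥0, (z ^ α) ^ (1 / α) = z := fun z => by
    rw [← NNReal.rpow_mul, mul_one_div_cancel hα, NNReal.rpow_one]
  have hle := h.coord_le_mul l (c := x⁻¹ ^ α) (by positivity) hx
  have hge := h.coord_le_mul l (c := x ^ α) (NNReal.rpow_pos hx) one_pos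
  rw [hroot, mul_one] at hge
  rw [hroot, inv_mul_cancel₀ hx.ne'] at hle
  rw [NNReal.rpow_neg, ← NNReal.inv_rpow, mul_comm]
  refine le_antisymm hle ?_
  calc _ ≤ ((x⁻¹ ^ α : ℝ≥0) : ℝ≥0∞) * ((x ^ α : ℝ≥0) * ν {w | x ≤ w l}) := by gcongr
    _ = ν {w | x ≤ w l} := by
      rw [← mul_assoc, ← ENNReal.coe_mul, ← NNReal.mul_rpow, inv_mul_cancel₀ hx.ne',
        NNReal.one_rpow, ENNReal.coe_one, one_mul]

end MRV

lemma exists_measure_lt_coord_ne_zero {l : Fin L} (hl : ν {x | 0 < x l} ≠ 0) :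
    ∃ y : ℝ≥0, 0 < y ∧ ν {w | y < w l} ≠ 0 := by
  by_contra! hcon
  have hset : {x : Cone L | 0 < x l} ⊆ ⋃ k : ℕ, {w | 1 / (k + 1 : ℝ≥0) < w l} := by
    intro w hw
    obtain ⟨k, hk⟩ := exists_nat_one_div_lt (K := ℝ≥0) (hw : 0 < w l)
    exact Set.mem_iUnion.2 ⟨k, hk⟩
  exact hl (measure_mono_null hset (measure_iUnion_null fun k => hcon _ (by positivity)))

namespace MRV

lemma coord_one_pos (h : MRV P α b ν) {l : Fin L} (hl : ν {x | 0 < x l} ≠ 0) :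
    0 < ν {w | 1 ≤ w l} := by
  obtain ⟨y, hy, hνy⟩ := exists_measure_lt_coord_ne_zero hl
  refine pos_iff_ne_zero.2 fun h0 => hνy (measure_mono_null (fun w (hw : y < w l) => hw.le) ?_)
  change ν {w | y ≤ w l} = 0
  rw [h.coord_eq_mul_rpow l hy, h0, zero_mul]

lemma tendsto_scaledTail (h : MRV P α b ν) (l : Fin L) {x : ℝ≥0} (hx : 0 < x) :
    Tendsto (fun t => scaledTail P b l t x) atTop
      (𝓝 (ν {w | 1 ≤ w l} * (x ^ (-α) : ℝ≥0))) := by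
  have hcont : Tendsto (fun z : ℝ≥0 => ν {w | 1 ≤ w l} * ((z ^ (-α) : ℝ≥0) : ℝ≥0∞)) (𝓝 x)
      (𝓝 (ν {w | 1 ≤ w l} * (x ^ (-α) : ℝ≥0))) := by
    refine ENNReal.Tendsto.const_mul (ENNReal.tendsto_coe.2 ?_)
      (Or.inr (h.coord_ne_top l one_pos))
    exact (NNReal.continuousAt_rpow_const (Or.inl hx.ne')).tendsto
  have : (𝓝[<] x).NeBot := nhdsLT_neBot_of_exists_lt ⟨0, hx⟩
  rw [tendsto_order]
  refine ⟨fun e he => ?_, fun e he => ?_⟩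
  · obtain ⟨y, hy, hxy : x < y⟩ := (((hcont.eventually (lt_mem_nhds he)).filter_mono
      (nhdsWithin_le_nhds (s := Set.Ioi x))).and self_mem_nhdsWithin).exists
    rw [← h.coord_eq_mul_rpow l (hx.trans hxy)] at hy
    exact h.eventually_lt_scaledTail l hx hxy hy
  · obtain ⟨y, ⟨hy, hy0⟩, hyx : y < x⟩ := ((((hcont.eventually (gt_mem_nhds he)).and
      (lt_mem_nhds hx)).filter_mono (nhdsWithin_le_nhds (s := Set.Iio x))).and
      self_mem_nhdsWithin).exists
    rw [← h.coord_eq_mul_rpow l hy0] at hy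
    exact h.eventually_scaledTail_lt l hy0 hyx hy

lemma measure_coord_pos_ne_zero (h : MRV P α b ν) {l : Fin L} (hl : ν {x | 0 < x l} ≠ 0) :
    P {w | 0 < w l} ≠ 0 := by
  intro h0
  have hlim := h.tendsto_scaledTail l one_pos
  have hzero : (fun t => scaledTail P b l t 1) = fun _ => 0 := by
    funext t
    have : P {w | 1 * b t < w l} = 0 :=
      measure_mono_null (fun w (hw : 1 * b t < w l) => (zero_le.trans_lt hw : 0 < w l)) h0
    rw [scaledTail, this, mul_zero]
  rw [hzero, NNReal.one_rpow, ENNReal.coe_one, mul_one] at hlim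
  exact (h.coord_one_pos hl).ne (tendsto_nhds_unique tendsto_const_nhds hlim)

lemma tendsto_scale [IsFiniteMeasure P] (h : MRV P α b ν) {l : Fin L}
    (hl : ν {x | 0 < x l} ≠ 0) : Tendsto b atTop atTop := by
  obtain ⟨y, hy, hPy⟩ := exists_measure_lt_coord_ne_zero (h.measure_coord_pos_ne_zero hl)
  refine tendsto_atTop.2 fun M => ?_
  have hx : 0 < y / (M + 1) := by positivity
  obtain ⟨e, he, he_top⟩ := exists_between (show
    ν {w | 1 ≤ w l} * ((y / (M + 1)) ^ (-α) : ℝ≥0) < ∞ from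
      ENNReal.mul_lt_top (h.coord_ne_top l one_pos).lt_top ENNReal.coe_lt_top)
  have hlarge : ∀ᶠ t : ℝ≥0 in atTop, e / P {w | y < w l} < t := by
    lift e / P {w | y < w l} to ℝ≥0 using ENNReal.div_ne_top he_top.ne hPy with d
    filter_upwards [eventually_gt_atTop d] with t ht using by exact_mod_cast ht
  filter_upwards [(h.tendsto_scaledTail l hx).eventually (gt_mem_nhds he), hlarge] with t htail ht
  by_contra! hcon
  have hle : y / (M + 1) * b t ≤ y := by
    calc y / (M + 1) * b t ≤ y / (M + 1) * (M + 1) := by gcongr; exact hcon.le.trans le_self_add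
      _ = y := by field_simp
  rw [ENNReal.div_lt_iff (Or.inl hPy) (Or.inl (measure_ne_top _ _))] at ht
  refine absurd (ht.trans_le ?_) (not_lt.2 htail.le)
  unfold scaledTail
  gcongr with w

end MRV

/-- The tail function `x ↦ P(W_l > x)` of the `l`-th coordinate of `W ∼ P`. -/
noncomputable def marginalTail (P : Measure (Cone L)) (l : Fin L) (x : ℝ) : ℝ :=
  P.real {w | x < (w l : ℝ)}

theorem MRV.regularlyVaryingTail [IsProbabilityMeasure P] (h : MRV P α b ν) {l : Fin L}
    (hl : ν {x | 0 < x l} ≠ 0) : RegularlyVaryingTail (marginalTail P l) α := by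
  have hfin := h.coord_ne_top l one_pos
  refine .of_tendsto_mul (B := fun n => b n.toNNReal) (c := ν.real {w | 1 ≤ w l})
    (fun x y hxy => measureReal_mono fun w (hw : y < (w l : ℝ)) => hxy.trans_lt hw)
    (fun x => measureReal_nonneg) (fun x => measureReal_le_one)
    (ENNReal.toReal_pos (h.coord_one_pos hl).ne' hfin) h.index_pos
    (NNReal.tendsto_coe_atTop.2 ((h.tendsto_scale hl).comp Real.tendsto_toNNReal_atTop))
    fun x hx => ?_
  lift x to ℝ≥0 using hx.le
  have hlim := (ENNReal.tendsto_toReal (ENNReal.mul_ne_top hfin ENNReal.coe_ne_top)).comp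
    ((h.tendsto_scaledTail l (by exact_mod_cast hx)).comp Real.tendsto_toNNReal_atTop)
  rw [ENNReal.toReal_mul, ENNReal.coe_toReal, NNReal.coe_rpow] at hlim
  refine hlim.congr' ?_
  filter_upwards [eventually_ge_atTop 0] with n hn
  simp only [Function.comp_apply, scaledTail, ENNReal.toReal_mul, ENNReal.coe_toReal,
    Real.coe_toNNReal n hn, marginalTail, Measure.real]
  norm_cast

end Marginal

/-! ### Marginal quantiles -/

section Quantile

variable {L : ℕ} {P : Measure (Cone L)}

lemma measurable_coord (l : Fin L) : Measurable fun w : Cone L => (w l : ℝ) :=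
  measurable_coe_nnreal_real.comp (measurable_pi_apply l)

lemma measurableSet_lt_coe_coord (l : Fin L) (x : ℝ) :
    MeasurableSet {w : Cone L | x < (w l : ℝ)} :=
  measurableSet_lt measurable_const (measurable_coord l)

lemma utd_mul_marginalTail {s m : Fin L} {q : ℝ}
    (hpos : 0 < marginalTail P s (marginalQuantile P s q)) :
    utd P s m q * marginalTail P s (marginalQuantile P s q) =
      P.real {w | marginalQuantile P s q < (w s : ℝ) ∧ marginalQuantile P m q < (w m : ℝ)} := by
  rw [utd, measureReal_def, cond_apply (measurableSet_lt_coe_coord s _), ENNReal.toReal_mul,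
    ENNReal.toReal_inv]
  change (marginalTail P s _)⁻¹ * _ * marginalTail P s _ = _
  rw [mul_right_comm, inv_mul_cancel₀ hpos.ne', one_mul]
  rfl

variable [IsProbabilityMeasure P]

lemma cdf_map_coord (l : Fin L) (x : ℝ) :
    cdf (P.map fun w => (w l : ℝ)) x = 1 - marginalTail P l x := by
  have : IsProbabilityMeasure (P.map fun w : Cone L => (w l : ℝ)) :=
    Measure.isProbabilityMeasure_map (measurable_coord l).aemeasurable
  rw [cdf_eq_real, map_measureReal_apply (measurable_coord l) measurableSet_Iic, marginalTail,
    ← probReal_compl_eq_one_sub (measurableSet_lt_coe_coord l x)]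
  congr 1
  ext w
  simp

lemma cdf_map_coord_of_neg (l : Fin L) {x : ℝ} (hx : x < 0) :
    cdf (P.map fun w => (w l : ℝ)) x = 0 := by
  have huniv : {w : Cone L | x < (w l : ℝ)} = Set.univ :=
    Set.eq_univ_of_forall fun w => hx.trans_le (w l).coe_nonneg
  rw [cdf_map_coord, marginalTail, huniv, probReal_univ, sub_self]

lemma marginalTail_marginalQuantile_le (l : Fin L) {q : ℝ} (hq : q < 1) :
    marginalTail P l (marginalQuantile P l q) ≤ 1 - q := by
  set F := cdf (P.map fun w : Cone L => (w l : ℝ)) with hF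
  have hne : {x | q ≤ F x}.Nonempty :=
    ((tendsto_cdf_atTop _).eventually (lt_mem_nhds hq)).exists.imp fun _ => le_of_lt
  have hright : Tendsto F (𝓝[>] (genInv F q)) (𝓝 (F (genInv F q))) :=
    (F.right_continuous _).mono Set.Ioi_subset_Ici_self
  have hle : q ≤ F (genInv F q) := by
    refine ge_of_tendsto hright ?_
    filter_upwards [self_mem_nhdsWithin] with z hz
    obtain ⟨y, hy, hyz⟩ := exists_lt_of_csInf_lt hne hz
    exact le_trans hy (F.mono hyz.le)
  rw [hF, cdf_map_coord] at hle
  exact le_sub_comm.1 hle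

lemma le_marginalTail_of_lt_marginalQuantile (l : Fin L) {q z : ℝ} (hq : 0 < q)
    (hz : z < marginalQuantile P l q) : 1 - q ≤ marginalTail P l z := by
  have hbdd : BddBelow {x | q ≤ cdf (P.map fun w => (w l : ℝ)) x} := by
    refine ⟨0, fun x hx => ?_⟩
    by_contra! hneg
    exact hq.not_ge (hx.trans_eq (cdf_map_coord_of_neg l hneg))
  have hlt : cdf (P.map fun w => (w l : ℝ)) z < q := by
    by_contra! hle
    exact (csInf_le hbdd hle).not_gt hz
  rw [cdf_map_coord] at hlt
  linarith

variable {α : ℝ} {ι : Type*} {f : Filter ι} {n : ι → ℝ}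

lemma eventually_mul_marginalTail_le_one (l : Fin L) (hn : Tendsto n f atTop) :
    ∀ᶠ i in f, n i * marginalTail P l (marginalQuantile P l (1 - (n i)⁻¹)) ≤ 1 := by
  filter_upwards [hn.eventually_gt_atTop 0] with i hi
  rw [← le_inv_mul_iff₀ hi, mul_one]
  simpa only [sub_sub_cancel] using
    marginalTail_marginalQuantile_le (P := P) l (sub_lt_self 1 (inv_pos.2 hi))

lemma eventually_one_le_mul_marginalTail (l : Fin L) (hn : Tendsto n f atTop) :
    ∀ᶠ i in f, ∀ z < marginalQuantile P l (1 - (n i)⁻¹), 1 ≤ n i * marginalTail P l z := by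
  filter_upwards [hn.eventually_gt_atTop 1] with i hi z hz
  rw [← inv_mul_le_iff₀ (one_pos.trans hi), mul_one]
  simpa only [sub_sub_cancel] using
    le_marginalTail_of_lt_marginalQuantile l (sub_pos.2 (inv_lt_one_of_one_lt₀ hi)) hz

lemma RegularlyVaryingTail.tendsto_marginalQuantile {l : Fin L}
    (h : RegularlyVaryingTail (marginalTail P l) α) (hn : Tendsto n f atTop) :
    Tendsto (fun i => marginalQuantile P l (1 - (n i)⁻¹)) f atTop :=
  h.tendsto_atTop_of_mul_le hn (eventually_mul_marginalTail_le_one l hn)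

lemma RegularlyVaryingTail.tendsto_mul_marginalTail {l : Fin L}
    (h : RegularlyVaryingTail (marginalTail P l) α) (hn : Tendsto n f atTop) :
    Tendsto (fun i => n i * marginalTail P l (marginalQuantile P l (1 - (n i)⁻¹))) f (𝓝 1) :=
  h.tendsto_mul_of_inversion hn (eventually_mul_marginalTail_le_one l hn)
    (eventually_one_le_mul_marginalTail l hn)

lemma RegularlyVaryingTail.tendsto_mul_joint_tail {s m : Fin L} {lam : ℝ}
    (h : RegularlyVaryingTail (marginalTail P s) α) (hlam : IsUTDCoefficient P s m lam)
    (hn : Tendsto n f atTop) :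
    Tendsto (fun i => n i * P.real {w | marginalQuantile P s (1 - (n i)⁻¹) < (w s : ℝ) ∧
      marginalQuantile P m (1 - (n i)⁻¹) < (w m : ℝ)}) f (𝓝 lam) := by
  have hlevel : Tendsto (fun i => 1 - (n i)⁻¹) f (𝓝[<] 1) := by
    refine tendsto_nhdsWithin_iff.2 ⟨by simpa using hn.inv_tendsto_atTop.const_sub 1, ?_⟩
    filter_upwards [hn.eventually_gt_atTop 0] with i hi using sub_lt_self 1 (inv_pos.2 hi)
  have hprod := (hlam.comp hlevel).mul (h.tendsto_mul_marginalTail hn)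
  rw [mul_one] at hprod
  refine hprod.congr fun i => ?_
  rw [← utd_mul_marginalTail (h.pos _), Function.comp_apply]
  ring

end Quantile

/-! ### Conditional laws of the degrees given the weights -/

section Poisson

lemma lintegral_exp_poissonMeasure (r : ℝ≥0) (θ : ℝ) :
    ∫⁻ n, ENNReal.ofReal (Real.exp (θ * n)) ∂poissonMeasure r =
      ENNReal.ofReal (Real.exp ((Real.exp θ - 1) * r)) := by
  have hsum : HasSum (fun n : ℕ => Real.exp (θ * n) * (Real.exp (-r) * r ^ n / n.factorial))
      (Real.exp ((Real.exp θ - 1) * r)) := by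
    have hexp := (NormedSpace.expSeries_div_hasSum_exp (r * Real.exp θ)).mul_left (Real.exp (-r))
    rw [← Real.exp_eq_exp_ℝ, ← Real.exp_add,
      show -(r : ℝ) + r * Real.exp θ = (Real.exp θ - 1) * r by ring] at hexp
    refine hexp.congr_fun fun n => ?_
    rw [mul_pow, ← Real.exp_nat_mul, mul_comm θ]
    ring
  rw [lintegral_countable', ← hsum.tsum_eq,
    ENNReal.ofReal_tsum_of_nonneg (fun n => by positivity) hsum.summable]
  refine tsum_congr fun n => ?_
  rw [poissonMeasure_singleton, ← ENNReal.ofReal_mul (by positivity)]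

lemma measurable_poissonMeasure_singleton (n : ℕ) :
    Measurable fun r : ℝ≥0 => poissonMeasure r {n} := by
  simp only [poissonMeasure_singleton]
  fun_prop

lemma tsum_prod_mul_prod_poissonMeasure {E : Type*} [Fintype E] (r : E → ℝ≥0)
    (φ : E → ℕ → ℝ≥0∞) :
    ∑' κ : E → ℕ, (∏ e, φ e (κ e)) * ∏ e, poissonMeasure (r e) {κ e} =
      ∏ e, ∫⁻ n, φ e n ∂poissonMeasure (r e) := by
  have hφ : ∀ e, Measurable (φ e) := fun e => measurable_of_countable _
  simp only [← Measure.pi_singleton (fun e => poissonMeasure (r e))]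
  rw [← lintegral_countable',
    lintegral_prod_eq_prod_lintegral_of_indepFun Finset.univ (fun e (κ : E → ℕ) => φ e (κ e))
      (iIndepFun_pi fun e => (hφ e).aemeasurable) fun e => (hφ e).comp (measurable_pi_apply e)]
  exact Finset.prod_congr rfl fun e _ =>
    (measurePreserving_eval (fun e => poissonMeasure (r e)) e).lintegral_comp (hφ e)

/-- The edge slots of the model: unordered pairs of nodes (loops included) in each layer, encoded
as triples `(i, j, l)` with `i ≤ j`. The entries of the adjacency tensor over these slots are the
conditionally independent ones. -/
abbrev EdgeSlot (N L : ℕ) : Type := {p : Fin N × Fin N × Fin L // p.1 ≤ p.2.1}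

lemma prod_edgeSlot {N L : ℕ} (f : Fin N → Fin N → Fin L → ℝ≥0∞) :
    ∏ i, ∏ j ∈ Finset.Ici i, ∏ l, f i j l = ∏ e : EdgeSlot N L, f e.1.1 e.1.2.1 e.1.2.2 := by
  classical
  have hsubtype : ∏ e : EdgeSlot N L, f e.1.1 e.1.2.1 e.1.2.2 =
      ∏ p : Fin N × Fin N × Fin L, if p.1 ≤ p.2.1 then f p.1 p.2.1 p.2.2 else 1 := by
    rw [← Finset.prod_filter]
    exact (Finset.prod_subtype (Finset.univ.filter fun p : Fin N × Fin N × Fin L => p.1 ≤ p.2.1)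
      (by simp) (fun p => f p.1 p.2.1 p.2.2)).symm
  rw [hsubtype, Fintype.prod_prod_type]
  refine Finset.prod_congr rfl fun i _ => ?_
  rw [Fintype.prod_prod_type, ← Finset.filter_le_eq_Ici, Finset.prod_filter]
  refine Finset.prod_congr rfl fun j _ => ?_
  by_cases h : i ≤ j <;> simp [h]

variable {Ω : Type*} {L N : ℕ} {g : Fin L → ℝ≥0 → ℝ≥0} {W : ℕ → Ω → Cone L}
  {A : (N : ℕ) → Fin N → Fin N → Fin L → Ω → ℕ}

/-- The conditional mean of the degree of a node given the weights. -/
noncomputable def meanDegree (g : Fin L → ℝ≥0 → ℝ≥0) (W : ℕ → Ω → Cone L) (N : ℕ) (i : Fin N)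
    (l : Fin L) (ω : Ω) : ℝ≥0 := ∑ j, edgeRate g W N i j l ω

lemma meanDegree_le {l : Fin L} {C : ℝ≥0} (hC : ∀ z, g l z ≤ C * z) (i : Fin N) (ω : Ω) :
    meanDegree g W N i l ω ≤ C * W i ω l :=
  calc ∑ j : Fin N, g l (W i ω l * W j ω l / totalWeight W N l ω)
      ≤ ∑ j : Fin N, C * (W i ω l * W j ω l / totalWeight W N l ω) :=
        Finset.sum_le_sum fun _ _ => hC _
    _ = C * W i ω l * (totalWeight W N l ω / totalWeight W N l ω) := by
        simp only [totalWeight, Finset.sum_div, Finset.mul_sum, mul_div_assoc, mul_assoc]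
    _ ≤ C * W i ω l := mul_le_of_le_one_right' (div_self_le_one _)

lemma exists_measurableSet_meanDegree_mem_iff (hg : ∀ l, Measurable (g l)) (i : Fin N) (l : Fin L)
    {I : Set ℝ≥0} (hI : MeasurableSet I) :
    ∃ S : Set (Fin N → Cone L), MeasurableSet S ∧ ∀ ω,
      (fun k : Fin N => W k ω) ∈ S ↔ meanDegree g W N i l ω ∈ I := by
  have hcoord : ∀ k : Fin N, Measurable fun w : Fin N → Cone L => w k l :=
    fun k => (measurable_pi_apply l).comp (measurable_pi_apply k)
  have hmean : Measurable fun w : Fin N → Cone L => ∑ j, g l (w i l * w j l / ∑ k, w k l) :=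
    Finset.measurable_sum _ fun j _ => (hg l).comp
      (((hcoord i).mul (hcoord j)).div (Finset.measurable_sum _ fun k _ => hcoord k))
  exact ⟨_, hmean hI, fun ω => Iff.rfl⟩

lemma edgeRate_comm (i j : Fin N) (l : Fin L) (ω : Ω) :
    edgeRate g W N i j l ω = edgeRate g W N j i l ω := by
  simp only [edgeRate, mul_comm]

/-- The slot of the unordered pair `{i, j}` in layer `l`. -/
def slot (i : Fin N) (l : Fin L) (j : Fin N) : EdgeSlot N L :=
  ⟨(min i j, max i j, l), min_le_max⟩

lemma slot_injective (i : Fin N) (l : Fin L) : Function.Injective (slot i l) := by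
  intro j j' h
  have hmin : min i j = min i j' := congrArg (fun e => e.1.1) h
  have hmax : max i j = max i j' := congrArg (fun e => e.1.2.1) h
  clear h
  grind

lemma apply_slot {β : Type*} {f : Fin N → Fin N → Fin L → β} (hf : ∀ i j l, f i j l = f j i l)
    (i j : Fin N) (l : Fin L) :
    f (slot i l j).1.1 (slot i l j).1.2.1 (slot i l j).1.2.2 = f i j l := by
  rcases le_total i j with h | h
  · simp [slot, h]
  · simp [slot, h, hf j]

variable [MeasurableSpace Ω] {μ : Measure Ω}

namespace IsMIRG

lemma measurable_edgeRate (hG : IsMIRG μ g W A) (N : ℕ) (i j : Fin N) (l : Fin L) :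
    Measurable (edgeRate g W N i j l) := by
  have hW : ∀ k : ℕ, Measurable fun ω => W k ω l :=
    fun k => (measurable_pi_apply l).comp (hG.measurable_weight k)
  unfold edgeRate totalWeight
  exact (hG.measurable_connection l).comp
    (((hW i).mul (hW j)).div (Finset.measurable_sum _ fun k _ => hW k))

lemma measurable_meanDegree (hG : IsMIRG μ g W A) (i : Fin N) (l : Fin L) :
    Measurable (meanDegree g W N i l) :=
  Finset.measurable_sum _ fun j _ => hG.measurable_edgeRate N i j l

lemma measurable_degree (hG : IsMIRG μ g W A) (i : Fin N) (l : Fin L) :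
    Measurable (degree A N i l) :=
  Finset.measurable_sum _ fun j _ => hG.measurable_adj N i j l

lemma cond_law_edgeSlot (hG : IsMIRG μ g W A) {S : Set (Fin N → Cone L)} (hS : MeasurableSet S)
    (κ : EdgeSlot N L → ℕ) :
    μ ({ω | (fun i : Fin N => W i ω) ∈ S} ∩
        {ω | (fun e : EdgeSlot N L => A N e.1.1 e.1.2.1 e.1.2.2 ω) = κ}) =
      ∫⁻ ω in {ω | (fun i : Fin N => W i ω) ∈ S}, ∏ e : EdgeSlot N L,
        poissonMeasure (edgeRate g W N e.1.1 e.1.2.1 e.1.2.2 ω) {κ e} ∂μ := by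
  set k : Fin N → Fin N → Fin L → ℕ := fun i j l => if h : i ≤ j then κ ⟨(i, j, l), h⟩ else 0
    with hk
  have hkκ : ∀ e : EdgeSlot N L, k e.1.1 e.1.2.1 e.1.2.2 = κ e := fun e => by
    simp only [hk, dif_pos e.2]
  have hlaw := hG.cond_law N k S hS
  simp only [prod_edgeSlot, hkκ] at hlaw
  rw [← hlaw]
  congr 2
  ext ω
  simp only [Set.mem_ofPred_eq, funext_iff, ← hkκ]
  exact ⟨fun h i j l hij => h ⟨(i, j, l), hij⟩, fun h e => h _ _ _ e.2⟩

lemma lintegral_prod_edgeSlot (hG : IsMIRG μ g W A) {S : Set (Fin N → Cone L)}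
    (hS : MeasurableSet S) (φ : EdgeSlot N L → ℕ → ℝ≥0∞) :
    ∫⁻ ω in {ω | (fun i : Fin N => W i ω) ∈ S}, ∏ e, φ e (A N e.1.1 e.1.2.1 e.1.2.2 ω) ∂μ =
      ∫⁻ ω in {ω | (fun i : Fin N => W i ω) ∈ S}, ∏ e : EdgeSlot N L,
        ∫⁻ n, φ e n ∂poissonMeasure (edgeRate g W N e.1.1 e.1.2.1 e.1.2.2 ω) ∂μ := by
  set T := {ω | (fun i : Fin N => W i ω) ∈ S}
  set X : Ω → EdgeSlot N L → ℕ := fun ω e => A N e.1.1 e.1.2.1 e.1.2.2 ω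
  have hX : Measurable X := measurable_pi_lambda _ fun e => hG.measurable_adj N _ _ _
  have hpmf : ∀ κ : EdgeSlot N L → ℕ, Measurable fun ω => ∏ e : EdgeSlot N L,
      poissonMeasure (edgeRate g W N e.1.1 e.1.2.1 e.1.2.2 ω) {κ e} := fun κ =>
    Finset.measurable_prod _ fun e _ =>
      (measurable_poissonMeasure_singleton _).comp (hG.measurable_edgeRate N _ _ _)
  have hlaw : ∀ κ : EdgeSlot N L → ℕ, (μ.restrict T).map X {κ} = ∫⁻ ω in T, ∏ e : EdgeSlot N L,
      poissonMeasure (edgeRate g W N e.1.1 e.1.2.1 e.1.2.2 ω) {κ e} ∂μ := fun κ => by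
    rw [Measure.map_apply hX (measurableSet_singleton κ),
      Measure.restrict_apply (hX (measurableSet_singleton κ)), Set.inter_comm,
      ← hG.cond_law_edgeSlot hS κ]
    rfl
  calc ∫⁻ ω in T, ∏ e, φ e (X ω e) ∂μ
      = ∫⁻ κ, ∏ e, φ e (κ e) ∂((μ.restrict T).map X) :=
        (lintegral_map (f := fun κ : EdgeSlot N L → ℕ => ∏ e, φ e (κ e))
          (measurable_of_countable _) hX).symm
    _ = ∑' κ : EdgeSlot N L → ℕ, ∫⁻ ω in T, (∏ e, φ e (κ e)) * ∏ e : EdgeSlot N L,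
          poissonMeasure (edgeRate g W N e.1.1 e.1.2.1 e.1.2.2 ω) {κ e} ∂μ := by
        simp only [lintegral_countable', hlaw, lintegral_const_mul _ (hpmf _)]
    _ = _ := by
        rw [← lintegral_tsum fun κ => ((hpmf κ).const_mul _).aemeasurable]
        exact lintegral_congr fun ω => tsum_prod_mul_prod_poissonMeasure _ φ

lemma lintegral_prod_adj (hG : IsMIRG μ g W A) {S : Set (Fin N → Cone L)}
    (hS : MeasurableSet S) (i : Fin N) (l : Fin L) (φ : ℕ → ℝ≥0∞) :
    ∫⁻ ω in {ω | (fun i : Fin N => W i ω) ∈ S}, ∏ j, φ (A N i j l ω) ∂μ =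
      ∫⁻ ω in {ω | (fun i : Fin N => W i ω) ∈ S},
        ∏ j, ∫⁻ n, φ n ∂poissonMeasure (edgeRate g W N i j l ω) ∂μ := by
  classical
  have hprod : ∀ f : EdgeSlot N L → ℝ≥0∞,
      ∏ e, (if e ∈ Finset.univ.image (slot i l) then f e else 1) = ∏ j, f (slot i l j) := by
    intro f
    rw [Finset.prod_ite_mem, Finset.univ_inter, Finset.prod_image]
    exact fun j _ j' _ h => slot_injective i l h
  have hslots := hG.lintegral_prod_edgeSlot hS
    (fun e n => if e ∈ Finset.univ.image (slot i l) then φ n else 1)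
  have hite : ∀ (e : EdgeSlot N L) (r : ℝ≥0),
      ∫⁻ n, (if e ∈ Finset.univ.image (slot i l) then φ n else 1) ∂poissonMeasure r =
        if e ∈ Finset.univ.image (slot i l) then ∫⁻ n, φ n ∂poissonMeasure r else 1 := by
    intro e r
    split_ifs <;> simp
  simp only [hite, hprod] at hslots
  convert hslots using 3 with ω ω
  · exact Finset.prod_congr rfl fun j _ => congrArg φ
      (apply_slot (f := fun i j l => A N i j l ω) (fun i j l => hG.symm N i j l ω) i j l).symm
  · refine Finset.prod_congr rfl fun j _ => ?_
    rw [apply_slot (f := fun i j l => edgeRate g W N i j l ω)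
      (fun i j l => edgeRate_comm i j l ω) i j l]

lemma lintegral_exp_degree (hG : IsMIRG μ g W A) {S : Set (Fin N → Cone L)}
    (hS : MeasurableSet S) (i : Fin N) (l : Fin L) (θ : ℝ) :
    ∫⁻ ω in {ω | (fun i : Fin N => W i ω) ∈ S},
        ENNReal.ofReal (Real.exp (θ * degree A N i l ω)) ∂μ =
      ∫⁻ ω in {ω | (fun i : Fin N => W i ω) ∈ S},
        ENNReal.ofReal (Real.exp ((Real.exp θ - 1) * meanDegree g W N i l ω)) ∂μ := by
  have hsum : ∀ (c : ℝ) (f : Fin N → ℝ), ENNReal.ofReal (Real.exp (c * ∑ j, f j)) =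
      ∏ j, ENNReal.ofReal (Real.exp (c * f j)) := fun c f => by
    rw [Finset.mul_sum, Real.exp_sum, ENNReal.ofReal_prod_of_nonneg fun _ _ => (Real.exp_pos _).le]
  simp only [degree, meanDegree, Nat.cast_sum, NNReal.coe_sum, hsum,
    ← lintegral_exp_poissonMeasure]
  exact hG.lintegral_prod_adj hS i l fun n => ENNReal.ofReal (Real.exp (θ * n))

variable [IsProbabilityMeasure μ]

lemma measure_meanDegree_mem_degree_le (hG : IsMIRG μ g W A) (i : Fin N) (l : Fin L)
    {I : Set ℝ≥0} (hI : MeasurableSet I) {θ b : ℝ} (hb : ∀ x ∈ I, (Real.exp θ - 1) * x ≤ b)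
    (y : ℝ) :
    μ {ω | meanDegree g W N i l ω ∈ I ∧ θ * y ≤ θ * degree A N i l ω} ≤
      ENNReal.ofReal (Real.exp (b - θ * y)) := by
  obtain ⟨S, hS, hSI⟩ := exists_measurableSet_meanDegree_mem_iff (W := W)
    hG.measurable_connection i l hI
  set T := {ω | (fun i : Fin N => W i ω) ∈ S}
  set c : ℝ≥0∞ := ENNReal.ofReal (Real.exp (θ * y))
  have hdegree : Measurable fun ω => ENNReal.ofReal (Real.exp (θ * degree A N i l ω)) :=
    (measurable_of_countable fun n : ℕ => ENNReal.ofReal (Real.exp (θ * n))).comp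
      (hG.measurable_degree i l)
  have hchain : c * μ {ω | meanDegree g W N i l ω ∈ I ∧ θ * y ≤ θ * degree A N i l ω} ≤
      ENNReal.ofReal (Real.exp b) :=
    calc _ ≤ c * μ.restrict T {ω | c ≤ ENNReal.ofReal (Real.exp (θ * degree A N i l ω))} := by
          refine mul_le_mul_right (le_trans (measure_mono fun ω hω => Set.mem_inter ?_ ?_)
            (Measure.le_restrict_apply _ _)) c
          · exact ENNReal.ofReal_le_ofReal (Real.exp_le_exp.2 hω.2)
          · exact (hSI ω).2 hω.1
      _ ≤ ∫⁻ ω in T, ENNReal.ofReal (Real.exp (θ * degree A N i l ω)) ∂μ :=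
          mul_meas_ge_le_lintegral hdegree c
      _ = ∫⁻ ω in T, ENNReal.ofReal (Real.exp ((Real.exp θ - 1) * meanDegree g W N i l ω)) ∂μ :=
          hG.lintegral_exp_degree hS i l θ
      _ ≤ ∫⁻ _ in T, ENNReal.ofReal (Real.exp b) ∂μ :=
          setLIntegral_mono measurable_const fun ω hω =>
            ENNReal.ofReal_le_ofReal (Real.exp_le_exp.2 (hb _ ((hSI ω).1 hω)))
      _ = ENNReal.ofReal (Real.exp b) * μ T := setLIntegral_const _ _
      _ ≤ ENNReal.ofReal (Real.exp b) := mul_le_of_le_one_right zero_le prob_le_one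
  rw [← add_sub_cancel (θ * y) b, Real.exp_add, ENNReal.ofReal_mul (Real.exp_pos _).le] at hchain
  exact (ENNReal.mul_le_mul_iff_right (by simp [Real.exp_pos]) ENNReal.ofReal_ne_top).1 hchain

lemma measure_meanDegree_le_degree_ge (hG : IsMIRG μ g W A) (i : Fin N) (l : Fin L) {ρ : ℝ}
    (hρ : 0 < ρ) (hρ1 : ρ ≤ 1) (y : ℝ) :
    μ {ω | (meanDegree g W N i l ω : ℝ) ≤ ρ * y ∧ y ≤ degree A N i l ω} ≤
      ENNReal.ofReal (Real.exp (-(ρ - 1 - Real.log ρ) * y)) := by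
  have hθ : 0 ≤ -Real.log ρ := neg_nonneg.2 (Real.log_nonpos hρ.le hρ1)
  have hbound := hG.measure_meanDegree_mem_degree_le i l (I := {x | (x : ℝ) ≤ ρ * y})
    (θ := -Real.log ρ) (b := (1 - ρ) * y) (measurableSet_le (by fun_prop) measurable_const)
    (fun x hx => ?_) y
  · rw [show (1 - ρ) * y - -Real.log ρ * y = -(ρ - 1 - Real.log ρ) * y by ring] at hbound
    exact (measure_mono fun ω hω => Set.mem_ofPred.2
      ⟨hω.1, mul_le_mul_of_nonneg_left hω.2 hθ⟩).trans hbound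
  · rw [Real.exp_neg, Real.exp_log hρ]
    calc (ρ⁻¹ - 1) * (x : ℝ) ≤ (ρ⁻¹ - 1) * (ρ * y) :=
          mul_le_mul_of_nonneg_left hx (sub_nonneg.2 ((one_le_inv₀ hρ).2 hρ1))
      _ = (1 - ρ) * y := by field_simp

lemma measure_meanDegree_ge_degree_le (hG : IsMIRG μ g W A) (i : Fin N) (l : Fin L) {ρ : ℝ}
    (hρ : 1 ≤ ρ) (y : ℝ) :
    μ {ω | ρ * y ≤ meanDegree g W N i l ω ∧ (degree A N i l ω : ℝ) ≤ y} ≤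
      ENNReal.ofReal (Real.exp (-(ρ - 1 - Real.log ρ) * y)) := by
  have hρ0 : 0 < ρ := one_pos.trans_le hρ
  have hθ : -Real.log ρ ≤ 0 := neg_nonpos.2 (Real.log_nonneg hρ)
  have hbound := hG.measure_meanDegree_mem_degree_le i l (I := {x | ρ * y ≤ x})
    (θ := -Real.log ρ) (b := (1 - ρ) * y) (measurableSet_le measurable_const (by fun_prop))
    (fun x hx => ?_) y
  · rw [show (1 - ρ) * y - -Real.log ρ * y = -(ρ - 1 - Real.log ρ) * y by ring] at hbound
    exact (measure_mono fun ω hω => Set.mem_ofPred.2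
      ⟨hω.1, mul_le_mul_of_nonpos_left hω.2 hθ⟩).trans hbound
  · rw [Real.exp_neg, Real.exp_log hρ0]
    calc (ρ⁻¹ - 1) * (x : ℝ) ≤ (ρ⁻¹ - 1) * (ρ * y) :=
          mul_le_mul_of_nonpos_left hx (sub_nonpos.2 (inv_le_one_of_one_le₀ hρ))
      _ = (1 - ρ) * y := by field_simp

end IsMIRG

end Poisson

/-! ### Sums over independent and identically distributed variables -/

section Whp

variable {Ω : Type*} [MeasurableSpace Ω]

/-- With high probability: the events `{ω | p N ω}` have probability tending to one as `N → ∞`. It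
is encoded by the (outer) probability of the complements, so the events need not be measurable. -/
def Whp (μ : Measure Ω) (p : ℕ → Ω → Prop) : Prop :=
  Tendsto (fun N => μ.real {ω | ¬ p N ω}) atTop (𝓝 0)

variable {μ : Measure Ω} {p q : ℕ → Ω → Prop}

lemma Whp.of_eventually_le {u : ℕ → ℝ} (hu : Tendsto u atTop (𝓝 0))
    (h : ∀ᶠ N in atTop, μ.real {ω | ¬ p N ω} ≤ u N) : Whp μ p :=
  squeeze_zero' (Eventually.of_forall fun _ => measureReal_nonneg) h hu

lemma Whp.of_forall_eventually_le
    (h : ∀ η : ℝ, 0 < η → ∀ᶠ N in atTop, μ.real {ω | ¬ p N ω} ≤ η) : Whp μ p := by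
  refine tendsto_order.2 ⟨fun e he => Eventually.of_forall fun N => he.trans_le measureReal_nonneg,
    fun e he => ?_⟩
  filter_upwards [h (e / 2) (half_pos he)] with N hN
  linarith

variable [IsFiniteMeasure μ]

lemma Whp.mono (hp : Whp μ p) (h : ∀ᶠ N in atTop, ∀ ω, p N ω → q N ω) : Whp μ q :=
  .of_eventually_le hp (h.mono fun N hN => measureReal_mono fun ω hω hpω => hω (hN ω hpω))

lemma Whp.and (hp : Whp μ p) (hq : Whp μ q) : Whp μ fun N ω => p N ω ∧ q N ω := by
  have hsum := Tendsto.add hp hq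
  rw [add_zero] at hsum
  refine .of_eventually_le hsum (Eventually.of_forall fun N => ?_)
  refine (measureReal_mono fun ω hω => ?_).trans (measureReal_union_le _ _)
  exact not_and_or.1 hω

end Whp

section IID

variable {Ω E : Type*} [MeasurableSpace Ω] [MeasurableSpace E] {μ : Measure Ω} {X : ℕ → Ω → E}
  {f : E → ℝ} {M : ℝ}

lemma integral_comp_eq (hX : ∀ i, IdentDistrib (X i) (X 0) μ μ) (hf : Measurable f) (i : ℕ) :
    ∫ ω, f (X i ω) ∂μ = ∫ x, f x ∂(μ.map (X 0)) := by
  rw [integral_map (hX 0).aemeasurable_fst hf.aestronglyMeasurable]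
  exact ((hX i).comp hf).integral_eq

lemma integrable_comp (hX : ∀ i, IdentDistrib (X i) (X 0) μ μ) (hf : Measurable f)
    (h_int : Integrable f (μ.map (X 0))) (i : ℕ) : Integrable (fun ω => f (X i ω)) μ :=
  ((hX i).comp hf).integrable_iff.2
    ((integrable_map_measure hf.aestronglyMeasurable (hX 0).aemeasurable_fst).1 h_int)

lemma integral_sum_comp (hX : ∀ i, IdentDistrib (X i) (X 0) μ μ) (hf : Measurable f)
    (h_int : Integrable f (μ.map (X 0))) (N : ℕ) :
    ∫ ω, ∑ i : Fin N, f (X i ω) ∂μ = N * ∫ x, f x ∂(μ.map (X 0)) := by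
  rw [integral_finsetSum _ fun (i : Fin N) _ => integrable_comp hX hf h_int i]
  simp [integral_comp_eq hX hf]

lemma measureReal_le_sum_comp (hX : ∀ i, IdentDistrib (X i) (X 0) μ μ) (hf : Measurable f)
    (h_int : Integrable f (μ.map (X 0))) (h0 : ∀ x, 0 ≤ f x) (N : ℕ) {δ : ℝ} (hδ : 0 < δ) :
    μ.real {ω | δ ≤ ∑ i : Fin N, f (X i ω)} ≤ N * (∫ x, f x ∂(μ.map (X 0))) / δ := by
  rw [le_div_iff₀ hδ, mul_comm, ← integral_sum_comp hX hf h_int]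
  exact mul_meas_ge_le_integral_of_nonneg (f := fun ω => ∑ i : Fin N, f (X i ω))
    (Eventually.of_forall fun ω => Finset.sum_nonneg fun i _ => h0 _)
    (integrable_finsetSum _ fun i _ => integrable_comp hX hf h_int i) δ

lemma integrable_of_nonneg_of_le {P : Measure E} [IsFiniteMeasure P] (hf : Measurable f)
    (h0 : ∀ x, 0 ≤ f x) (hM : ∀ x, f x ≤ M) : Integrable f P :=
  .of_bound hf.aestronglyMeasurable M
    (Eventually.of_forall fun x => (Real.norm_of_nonneg (h0 x)).trans_le (hM x))

variable [IsProbabilityMeasure μ]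

lemma variance_comp_le (hX : ∀ i, IdentDistrib (X i) (X 0) μ μ) (hf : Measurable f)
    (h0 : ∀ x, 0 ≤ f x) (hM : ∀ x, f x ≤ M) (i : ℕ) :
    variance (fun ω => f (X i ω)) μ ≤ M * ∫ x, f x ∂(μ.map (X 0)) := by
  have hmeas := ((hX i).comp hf).aemeasurable_fst.aestronglyMeasurable
  have hmem : MemLp (f ∘ X i) 2 μ := .of_bound hmeas M
    (Eventually.of_forall fun ω => (Real.norm_of_nonneg (h0 _)).trans_le (hM _))
  refine (variance_le_expectation_sq hmeas).trans ?_
  rw [← integral_comp_eq hX hf i, ← integral_const_mul]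
  refine integral_mono hmem.integrable_sq ((hmem.integrable one_le_two).const_mul M) fun ω => ?_
  simp only [Pi.pow_apply, sq, Function.comp_apply]
  exact mul_le_mul_of_nonneg_right (hM _) (h0 _)

lemma measureReal_le_abs_sum_comp_sub (hindep : iIndepFun X μ)
    (hX : ∀ i, IdentDistrib (X i) (X 0) μ μ) (hf : Measurable f) (h0 : ∀ x, 0 ≤ f x)
    (hM : ∀ x, f x ≤ M) (N : ℕ) {δ : ℝ} (hδ : 0 < δ) :
    μ.real {ω | δ ≤ |∑ i : Fin N, f (X i ω) - N * ∫ x, f x ∂(μ.map (X 0))|} ≤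
      N * M * (∫ x, f x ∂(μ.map (X 0))) / δ ^ 2 := by
  have := Measure.isProbabilityMeasure_map (hX 0).aemeasurable_fst
  have h_int := integrable_of_nonneg_of_le (P := μ.map (X 0)) hf h0 hM
  have hmem : ∀ i : Fin N, MemLp (fun ω => f (X i ω)) 2 μ := fun i =>
    .of_bound ((hX i).comp hf).aemeasurable_fst.aestronglyMeasurable M
      (Eventually.of_forall fun ω => (Real.norm_of_nonneg (h0 _)).trans_le (hM _))
  have hvar : variance (∑ i : Fin N, fun ω => f (X i ω)) μ ≤
      N * M * ∫ x, f x ∂(μ.map (X 0)) := by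
    rw [IndepFun.variance_sum (fun i _ => hmem i) fun i _ j _ hij =>
      (hindep.indepFun (Fin.val_ne_of_ne hij)).comp hf hf]
    refine (Finset.sum_le_sum fun (i : Fin N) _ => variance_comp_le hX hf h0 hM i).trans ?_
    simp [mul_assoc]
  have hcheb := meas_ge_le_variance_div_sq (memLp_finsetSum' Finset.univ fun i _ => hmem i) hδ
  simp only [Finset.sum_apply, integral_sum_comp hX hf h_int] at hcheb
  refine (ENNReal.toReal_mono ENNReal.ofReal_ne_top hcheb).trans ?_
  rw [ENNReal.toReal_ofReal (div_nonneg (variance_nonneg _ _) (by positivity))]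
  gcongr

lemma whp_sum_indicator_near (hindep : iIndepFun X μ) (hX : ∀ i, IdentDistrib (X i) (X 0) μ μ)
    {t : ℕ → ℝ} (ht : Tendsto t atTop atTop) {S : ℕ → Set E} (hS : ∀ N, MeasurableSet (S N))
    {v : ℝ} (hv : Tendsto (fun N : ℕ => N / t N * (μ.map (X 0)).real (S N)) atTop (𝓝 v))
    {ε : ℝ} (hε : 0 < ε) :
    Whp μ fun N ω =>
      |∑ i : Fin N, (S N).indicator (1 : E → ℝ) (X i ω) - v * t N| ≤ ε * t N := by
  have hbound : Tendsto (fun N : ℕ => N / t N * (μ.map (X 0)).real (S N) / (ε / 2) ^ 2 / t N)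
      atTop (𝓝 0) := (hv.div_const _).div_atTop ht
  refine .of_eventually_le hbound ?_
  filter_upwards [ht.eventually_gt_atTop 0, hv.eventually (Metric.ball_mem_nhds v (half_pos hε))]
    with N hN hNv
  have hcheb := measureReal_le_abs_sum_comp_sub (M := 1) hindep hX (measurable_one.indicator (hS N))
    (Set.indicator_nonneg fun _ _ => zero_le_one) (Set.indicator_le_self' fun _ _ => zero_le_one)
    N (mul_pos (half_pos hε) hN)
  rw [integral_indicator_one (hS N)] at hcheb
  set p := (μ.map (X 0)).real (S N)
  have hmean : |N * p - v * t N| ≤ ε / 2 * t N := by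
    rw [Real.dist_eq] at hNv
    rw [show N * p - v * t N = (N / t N * p - v) * t N by field_simp, abs_mul, abs_of_pos hN]
    gcongr
  refine (measureReal_mono fun ω hω => Set.mem_ofPred.2 ?_).trans (hcheb.trans_eq ?_)
  · have htri := abs_sub_le (∑ i : Fin N, (S N).indicator (1 : E → ℝ) (X i ω)) (N * p) (v * t N)
    have hfar := not_le.1 hω
    linarith
  · field_simp

end IID

/-! ### The total weight of a layer -/

/-- `τ` is the scale of the sums of `N` independent variables `W_i` with tail function `F`: the
solution of `N E[W ∧ τ_N] = τ_N`, for all large `N`. It is proportional to `N` if `W` has finite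
mean. -/
structure IsSumScale (F : ℝ → ℝ) (τ : ℕ → ℝ) : Prop where
  one_le : ∀ᶠ N in atTop, 1 ≤ τ N
  balance : ∀ᶠ N : ℕ in atTop, N * RegularlyVaryingTail.truncatedMean F (τ N) = τ N

section SumScale

open RegularlyVaryingTail

variable {F : ℝ → ℝ} {α : ℝ} {τ : ℕ → ℝ}

lemma RegularlyVaryingTail.eventually_exists_balance (h : RegularlyVaryingTail F α) :
    ∀ᶠ N : ℕ in atTop, ∃ τ : ℝ, 1 ≤ τ ∧ N * truncatedMean F τ = τ := by
  have hone : ∀ᶠ N : ℕ in atTop, 1 / truncatedMean F 1 < (N : ℝ) :=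
    tendsto_natCast_atTop_atTop.eventually_gt_atTop _
  filter_upwards [hone, eventually_gt_atTop 0] with N hN hN0
  have hN0' : (0 : ℝ) < N := by exact_mod_cast hN0
  rw [div_lt_iff₀ (h.truncatedMean_pos one_pos)] at hN
  obtain ⟨y, hy, hy1⟩ := ((h.truncatedMean_div_tendsto_zero.eventually
    (gt_mem_nhds (one_div_pos.2 hN0'))).and (eventually_ge_atTop 1)).exists
  have hy0 : 0 < y := one_pos.trans_le hy1
  rw [div_lt_div_iff₀ hy0 hN0'] at hy
  have hcont : ContinuousOn (fun x => N * truncatedMean F x - x) (Set.Icc 1 y) :=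
    (((continuous_truncatedMean h.anti).const_mul _).sub continuous_id).continuousOn
  obtain ⟨τ, hτ, hτ0⟩ := intermediate_value_Icc' hy1 hcont
    (show (0 : ℝ) ∈ Set.Icc (N * truncatedMean F y - y) (N * truncatedMean F 1 - 1) from
      ⟨by linarith, by linarith⟩)
  exact ⟨τ, hτ.1, sub_eq_zero.1 hτ0⟩

lemma RegularlyVaryingTail.exists_isSumScale (h : RegularlyVaryingTail F α) :
    ∃ τ, IsSumScale F τ := by
  choose! τ hτ using fun (N : ℕ) (hN : ∃ τ : ℝ, 1 ≤ τ ∧ N * truncatedMean F τ = τ) => hN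
  exact ⟨τ, h.eventually_exists_balance.mono fun N hN => (hτ N hN).1,
    h.eventually_exists_balance.mono fun N hN => (hτ N hN).2⟩

lemma IsSumScale.eventually_mul_le (hτ : IsSumScale F τ) (h : RegularlyVaryingTail F α) :
    ∀ᶠ N : ℕ in atTop, N * truncatedMean F 1 ≤ τ N := by
  filter_upwards [hτ.one_le, hτ.balance] with N hone hbal
  calc N * truncatedMean F 1 ≤ N * truncatedMean F (τ N) := by
        gcongr; exact h.monotone_truncatedMean hone
    _ = τ N := hbal

lemma IsSumScale.tendsto_atTop (hτ : IsSumScale F τ) (h : RegularlyVaryingTail F α) :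
    Tendsto τ atTop atTop :=
  tendsto_atTop_mono' _ (hτ.eventually_mul_le h)
    (tendsto_natCast_atTop_atTop.atTop_mul_const (h.truncatedMean_pos one_pos))

end SumScale

section TotalWeight

open RegularlyVaryingTail

variable {L : ℕ} {l : Fin L}

lemma measurable_min_coord (l : Fin L) (y : ℝ) : Measurable fun w : Cone L => min (w l : ℝ) y :=
  (measurable_coord l).min measurable_const

lemma min_coord_nonneg (l : Fin L) {y : ℝ} (hy : 0 ≤ y) (w : Cone L) : 0 ≤ min (w l : ℝ) y :=
  le_min (w l).coe_nonneg hy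

lemma integrable_min_coord {P : Measure (Cone L)} [IsFiniteMeasure P] {y : ℝ} (hy : 0 ≤ y) :
    Integrable (fun w => min (w l : ℝ) y) P :=
  integrable_of_nonneg_of_le (measurable_min_coord l y) (min_coord_nonneg l hy) fun _ =>
    min_le_right _ _

lemma integral_min_coord {P : Measure (Cone L)} [IsFiniteMeasure P] {y : ℝ} (hy : 0 ≤ y) :
    ∫ w, min (w l : ℝ) y ∂P = truncatedMean (marginalTail P l) y := by
  rw [(integrable_min_coord hy).integral_eq_integral_meas_lt
    (Eventually.of_forall (min_coord_nonneg l hy))]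
  have htail : ∀ u : ℝ, P.real {w | u < min (w l : ℝ) y} =
      (Set.Iio y).indicator (marginalTail P l) u := by
    intro u
    by_cases hu : u < y
    · simp [hu, marginalTail]
    · simp [hu]
  simp only [htail]
  rw [setIntegral_indicator measurableSet_Iio, Set.Ioi_inter_Iio, ← integral_Ioc_eq_integral_Ioo,
    truncatedMean, intervalIntegral.integral_of_le hy]

variable {Ω : Type*} {W : ℕ → Ω → Cone L} {N : ℕ}

lemma coe_totalWeight (l : Fin L) (ω : Ω) :
    (totalWeight W N l ω : ℝ) = ∑ i : Fin N, (W i ω l : ℝ) := by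
  simp [totalWeight]

lemma le_sum_min_of_le_totalWeight {y : ℝ} (hy : 0 ≤ y) {ω : Ω} (h : y ≤ totalWeight W N l ω) :
    y ≤ ∑ i : Fin N, min (W i ω l : ℝ) y := by
  by_cases hex : ∃ i : Fin N, y ≤ (W i ω l : ℝ)
  · obtain ⟨i, hi⟩ := hex
    calc y = min (W i ω l : ℝ) y := (min_eq_right hi).symm
      _ ≤ _ := Finset.single_le_sum (f := fun i : Fin N => min (W i ω l : ℝ) y)
        (fun j _ => min_coord_nonneg l hy (W j ω)) (Finset.mem_univ i)
  · push Not at hex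
    rw [coe_totalWeight] at h
    exact h.trans_eq (Finset.sum_congr rfl fun i _ => (min_eq_left (hex i).le).symm)

lemma sum_min_le_totalWeight (y : ℝ) (ω : Ω) :
    ∑ i : Fin N, min (W i ω l : ℝ) y ≤ totalWeight W N l ω := by
  rw [coe_totalWeight]
  exact Finset.sum_le_sum fun i _ => min_le_left _ _

variable [MeasurableSpace Ω] {μ : Measure Ω} [IsProbabilityMeasure μ]

lemma measureReal_le_totalWeight (hW : ∀ i, IdentDistrib (W i) (W 0) μ μ) {y : ℝ} (hy : 0 < y) :
    μ.real {ω | y ≤ totalWeight W N l ω} ≤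
      N * truncatedMean (marginalTail (μ.map (W 0)) l) y / y := by
  have := Measure.isProbabilityMeasure_map (hW 0).aemeasurable_fst
  rw [← integral_min_coord hy.le]
  exact (measureReal_mono fun ω hω => le_sum_min_of_le_totalWeight hy.le hω).trans
    (measureReal_le_sum_comp hW (measurable_min_coord l y) (integrable_min_coord hy.le)
      (min_coord_nonneg l hy.le) N hy)

lemma measureReal_totalWeight_le (hindep : iIndepFun W μ)
    (hW : ∀ i, IdentDistrib (W i) (W 0) μ μ) {z : ℝ} (hz : 0 ≤ z)
    (hpos : 0 < N * truncatedMean (marginalTail (μ.map (W 0)) l) z) :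
    μ.real {ω | totalWeight W N l ω ≤ N * truncatedMean (marginalTail (μ.map (W 0)) l) z / 2} ≤
      4 * (z / (N * truncatedMean (marginalTail (μ.map (W 0)) l) z)) := by
  have := Measure.isProbabilityMeasure_map (hW 0).aemeasurable_fst
  have hcheb := measureReal_le_abs_sum_comp_sub hindep hW (measurable_min_coord l z)
    (min_coord_nonneg l hz) (fun _ => min_le_right _ _) N (half_pos hpos)
  rw [integral_min_coord hz] at hcheb
  set e := N * truncatedMean (marginalTail (μ.map (W 0)) l) z with he
  refine (measureReal_mono fun ω hω => Set.mem_ofPred.2 ?_).trans (hcheb.trans_eq ?_)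
  · have hhalf : (totalWeight W N l ω : ℝ) ≤ e / 2 := hω
    rw [abs_sub_comm]
    exact le_trans (by linarith [sum_min_le_totalWeight (W := W) (N := N) (l := l) z ω])
      (le_abs_self _)
  · rw [mul_right_comm, ← he]
    field_simp
    norm_num

section Doubling

variable {r Y T : ℝ}

lemma measureReal_two_pow_mul_le_totalWeight (hW : ∀ i, IdentDistrib (W i) (W 0) μ μ)
    (hr : 0 ≤ r) (hY : 0 < Y)
    (hd : ∀ y, Y ≤ y → truncatedMean (marginalTail (μ.map (W 0)) l) (2 * y) ≤
      r * truncatedMean (marginalTail (μ.map (W 0)) l) y) (hT : Y ≤ T)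
    (hbal : N * truncatedMean (marginalTail (μ.map (W 0)) l) T = T) (k : ℕ) :
    μ.real {ω | 2 ^ k * T ≤ totalWeight W N l ω} ≤ (r / 2) ^ k := by
  have hT0 : 0 < T := hY.trans_le hT
  refine (measureReal_le_totalWeight hW (by positivity)).trans ?_
  rw [div_le_iff₀ (by positivity)]
  set m := truncatedMean (marginalTail (μ.map (W 0)) l)
  calc N * m (2 ^ k * T) ≤ N * (r ^ k * m T) := by
        gcongr; exact le_pow_mul_of_doubling hr hY.le hd k hT
    _ = r ^ k * (N * m T) := by ring
    _ = (r / 2) ^ k * (2 ^ k * T) := by rw [hbal, div_pow]; field_simp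

lemma measureReal_two_pow_mul_totalWeight_lt (hindep : iIndepFun W μ)
    (hW : ∀ i, IdentDistrib (W i) (W 0) μ μ) (hr : 0 ≤ r) (hr2 : r ≤ 2) (hY : 0 < Y)
    (hd : ∀ y, Y ≤ y → truncatedMean (marginalTail (μ.map (W 0)) l) (2 * y)
      ≤ r * truncatedMean (marginalTail (μ.map (W 0)) l) y) (k : ℕ) (hT : 2 ^ k * Y ≤ T)
    (hbal : N * truncatedMean (marginalTail (μ.map (W 0)) l) T = T) :
    μ.real {ω | 2 * 2 ^ k * totalWeight W N l ω < T} ≤ 4 * (r / 2) ^ k := by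
  have hT0 : 0 < T := (mul_pos (by positivity) hY).trans_le hT
  set z := T / 2 ^ k with hz
  have hzY : Y ≤ z := by rwa [hz, le_div_iff₀ (by positivity), mul_comm]
  set m := truncatedMean (marginalTail (μ.map (W 0)) l)
  have hTz : T ≤ r ^ k * (N * m z) := by
    calc T = N * m (2 ^ k * z) := by rw [hz, mul_div_cancel₀ T (by positivity), hbal]
      _ ≤ N * (r ^ k * m z) := by gcongr; exact le_pow_mul_of_doubling hr hY.le hd k hzY
      _ = r ^ k * (N * m z) := by ring
  have hpos : 0 < N * m z := pos_of_mul_pos_right (hT0.trans_le hTz) (by positivity)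
  refine (measureReal_mono fun ω hω => Set.mem_ofPred.2 ?_).trans
    ((measureReal_totalWeight_le hindep hW (hY.le.trans hzY) hpos).trans ?_)
  · have hlt : 2 * 2 ^ k * (totalWeight W N l ω : ℝ) < 2 ^ k * (N * m z) :=
      (Set.mem_ofPred.1 hω).trans_le (hTz.trans (by gcongr))
    rw [mul_comm 2, mul_assoc] at hlt
    linarith [lt_of_mul_lt_mul_left hlt (by positivity)]
  · gcongr
    rw [div_le_iff₀ hpos, hz, div_le_iff₀ (by positivity)]
    calc T ≤ r ^ k * (N * m z) := hTz
      _ = (r / 2) ^ k * (N * m z) * 2 ^ k := by rw [div_pow]; field_simp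

end Doubling

lemma exists_totalWeight_tight {α : ℝ} (hindep : iIndepFun W μ)
    (hW : ∀ i, IdentDistrib (W i) (W 0) μ μ)
    (h : RegularlyVaryingTail (marginalTail (μ.map (W 0)) l) α) {τ : ℕ → ℝ}
    (hτ : IsSumScale (marginalTail (μ.map (W 0)) l) τ) {η : ℝ} (hη : 0 < η) :
    ∃ K : ℝ, 0 < K ∧ ∀ᶠ N in atTop,
      μ.real {ω | ¬ (τ N ≤ K * totalWeight W N l ω ∧ totalWeight W N l ω ≤ K * τ N)} ≤ η := by
  obtain ⟨r, Y, hr1, hr2, hY, hd⟩ := h.truncatedMean_doubling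
  have hr0 : 0 ≤ r := zero_le_one.trans hr1
  have hlim : Tendsto (fun k : ℕ => 5 * (r / 2) ^ k) atTop (𝓝 (5 * 0)) :=
    (tendsto_pow_atTop_nhds_zero_of_lt_one (by positivity) (by linarith)).const_mul 5
  obtain ⟨k, hk⟩ := (hlim.eventually (gt_mem_nhds (show 5 * 0 < η by simpa using hη))).exists
  refine ⟨2 * 2 ^ k, by positivity, ?_⟩
  filter_upwards [hτ.balance, (hτ.tendsto_atTop h).eventually_ge_atTop (2 ^ k * Y)]
    with N hbal hNY
  have hYτ : Y ≤ τ N := (le_mul_of_one_le_left hY.le (one_le_pow₀ one_le_two)).trans hNY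
  have hτ0 : 0 < τ N := hY.trans_le hYτ
  have hupper := measureReal_two_pow_mul_le_totalWeight hW hr0 hY hd hYτ hbal k
  have hlower := measureReal_two_pow_mul_totalWeight_lt hindep hW hr0 hr2.le hY hd k hNY hbal
  calc _ ≤ μ.real ({ω | 2 ^ k * τ N ≤ totalWeight W N l ω} ∪
        {ω | 2 * 2 ^ k * totalWeight W N l ω < τ N}) := by
        refine measureReal_mono fun ω hω => ?_
        by_contra hout
        simp only [Set.mem_union, Set.mem_ofPred_eq, not_or, not_le, not_lt] at hout
        have : 0 < 2 ^ k * τ N := by positivity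
        exact hω ⟨hout.2, by linarith [hout.1]⟩
    _ ≤ (r / 2) ^ k + 4 * (r / 2) ^ k :=
        (measureReal_union_le _ _).trans (add_le_add hupper hlower)
    _ ≤ η := by linarith

end TotalWeight

/-! ### Levels with a prescribed tail -/

lemma tendsto_div_atTop_of_tendsto_div_zero {ι : Type*} {f : Filter ι} {u v : ι → ℝ}
    (hu : ∀ᶠ i in f, 0 < u i) (hv : ∀ᶠ i in f, 0 < v i)
    (h : Tendsto (fun i => u i / v i) f (𝓝 0)) : Tendsto (fun i => v i / u i) f atTop := by
  have hpos : ∀ᶠ i in f, 0 < u i / v i := (hu.and hv).mono fun i hi => div_pos hi.1 hi.2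
  simpa only [inv_div, Function.comp_def] using
    tendsto_inv_nhdsGT_zero.comp (tendsto_nhdsWithin_iff.2 ⟨h, hpos⟩)

/-- `a N` is asymptotically the level that a variable with tail function `F` exceeds with
probability `1 / n N`, that is, its `(1 - 1 / n N)`-quantile. -/
structure IsTailLevel (F : ℝ → ℝ) (n a : ℕ → ℝ) : Prop where
  tendsto_atTop : Tendsto a atTop atTop
  tendsto_mul : Tendsto (fun N => n N * F (a N)) atTop (𝓝 1)

namespace IsTailLevel

open RegularlyVaryingTail

variable {F : ℝ → ℝ} {α : ℝ} {n a : ℕ → ℝ}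

lemma of_marginalQuantile {L : ℕ} {P : Measure (Cone L)} [IsProbabilityMeasure P] {l : Fin L}
    (h : RegularlyVaryingTail (marginalTail P l) α) (hn : Tendsto n atTop atTop) :
    IsTailLevel (marginalTail P l) n fun N => marginalQuantile P l (1 - (n N)⁻¹) :=
  ⟨h.tendsto_marginalQuantile hn, h.tendsto_mul_marginalTail hn⟩

lemma tendsto_mul_rpow (ha : IsTailLevel F n a) (h : RegularlyVaryingTail F α) {x : ℝ}
    (hx : 0 < x) : Tendsto (fun N => n N * F (x * a N)) atTop (𝓝 (x ^ (-α))) := by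
  have hprod := ha.tendsto_mul.mul ((h.tendsto_ratio x hx).comp ha.tendsto_atTop)
  rw [one_mul] at hprod
  refine hprod.congr fun N => ?_
  have hpos := h.pos (a N)
  simp only [Function.comp_apply]
  field_simp

lemma tendsto_mul_exp (ha : IsTailLevel F n a) (h : RegularlyVaryingTail F α) {κ : ℝ}
    (hκ : 0 < κ) : Tendsto (fun N => n N * Real.exp (-κ * a N)) atTop (𝓝 0) := by
  have hprod := ha.tendsto_mul.mul ((h.tendsto_exp_div hκ).comp ha.tendsto_atTop)
  rw [mul_zero] at hprod
  refine hprod.congr fun N => ?_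
  have hpos := h.pos (a N)
  simp only [Function.comp_apply]
  field_simp

lemma tendsto_div_atTop (ha : IsTailLevel F n a) (h : RegularlyVaryingTail F α) {M : ℝ}
    (hM : Tendsto (truncatedMean F) atTop (𝓝 M)) : Tendsto (fun N => n N / a N) atTop atTop := by
  have hdiv := ((h.mul_tendsto_zero hM).comp ha.tendsto_atTop).div ha.tendsto_mul one_ne_zero
  rw [zero_div] at hdiv
  have hpos : ∀ᶠ N in atTop, 0 < n N :=
    (ha.tendsto_mul.eventually (lt_mem_nhds one_pos)).mono fun N hN =>
      pos_of_mul_pos_left hN (h.nonneg _)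
  exact tendsto_div_atTop_of_tendsto_div_zero (ha.tendsto_atTop.eventually_gt_atTop 0) hpos
    (hdiv.congr fun N => mul_div_mul_right _ _ (h.pos (a N)).ne')

end IsTailLevel

lemma IsIntermediate.tendsto_div {t : ℕ → ℕ} (ht : IsIntermediate t) :
    Tendsto (fun N : ℕ => (N : ℝ) / t N) atTop atTop :=
  tendsto_div_atTop_of_tendsto_div_zero
    ((tendsto_natCast_atTop_atTop.comp ht.tendsto_atTop).eventually_gt_atTop 0)
    (tendsto_natCast_atTop_atTop.eventually_gt_atTop 0) ht.tendsto_ratio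

/-! ### Conditional mean degrees -/

section ConnectionFunction

variable {g : ℝ≥0 → ℝ≥0} {δ : ℝ}

lemma abs_sub_le_of_dist_div_lt {z : ℝ≥0} (hz : 0 < z) (h : dist (g z / z) 1 < δ) :
    |(g z : ℝ) - z| ≤ δ * z := by
  have hz' : (0 : ℝ) < z := NNReal.coe_pos.2 hz
  rw [NNReal.dist_eq, NNReal.coe_div, NNReal.coe_one] at h
  rw [show (g z : ℝ) - z = (g z / z - 1) * z by field_simp, abs_mul, abs_of_pos hz']
  gcongr

lemma exists_near_top (hg : Tendsto (fun x => g x / x) atTop (𝓝 1)) (hδ : 0 < δ) :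
    ∃ M : ℝ, 0 < M ∧ ∀ z : ℝ≥0, M ≤ z → |(g z : ℝ) - z| ≤ δ * z := by
  obtain ⟨M, hM⟩ := eventually_atTop.1 (hg.eventually (Metric.ball_mem_nhds 1 hδ))
  refine ⟨M + 1, by positivity, fun z hz => ?_⟩
  have hz' : M + 1 ≤ z := by exact_mod_cast hz
  exact abs_sub_le_of_dist_div_lt (lt_of_lt_of_le (by positivity) hz')
    (hM z (le_self_add.trans hz'))

namespace IsConnectionFunction

lemma map_zero (hg : IsConnectionFunction g) : g 0 = 0 := by
  obtain ⟨C, hC⟩ := hg.linear_bound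
  simpa using hC 0

lemma exists_near_zero (hg : IsConnectionFunction g) (hδ : 0 < δ) :
    ∃ η : ℝ, 0 < η ∧ ∀ z : ℝ≥0, z ≤ η → |(g z : ℝ) - z| ≤ δ * z := by
  have hnear := hg.tendsto_zero.eventually (Metric.ball_mem_nhds 1 hδ)
  rw [eventually_nhdsWithin_iff, Metric.eventually_nhds_iff] at hnear
  obtain ⟨η, hη, h⟩ := hnear
  refine ⟨η / 2, half_pos hη, fun z hz => ?_⟩
  rcases eq_or_ne z 0 with rfl | hz0
  · simp [hg.map_zero]
  · have hzpos : 0 < z := pos_iff_ne_zero.2 hz0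
    refine abs_sub_le_of_dist_div_lt hzpos (h ?_ hzpos)
    rw [NNReal.dist_eq, NNReal.coe_zero, sub_zero, NNReal.abs_eq]
    linarith

end IsConnectionFunction

end ConnectionFunction

section Window

open RegularlyVaryingTail

variable {L : ℕ} {P : Measure (Cone L)} {l : Fin L} {α : ℝ} {τ : ℕ → ℝ} {g : ℝ≥0 → ℝ≥0}

/-- A window `S N` of exceptional weights in layer `l`: they carry a negligible part of the total
weight, and at all other weights `x` the function `g` is close to the identity at `w x / T`, for all
weights `w` between `ε a_N` and `K₁ a_N` and all total weights `T` on the scale `τ_N`. -/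
structure IsWindow (P : Measure (Cone L)) (l : Fin L) (g : ℝ≥0 → ℝ≥0) (a τ : ℕ → ℝ)
    (δ ε K₁ K : ℝ) (S : ℕ → Set ℝ) : Prop where
  measurable : ∀ N, MeasurableSet (S N)
  integrable : ∀ N, Integrable (fun w => (S N).indicator id (w l : ℝ)) P
  mass : Tendsto (fun N => (∫ w, (S N).indicator id (w l : ℝ) ∂P) /
    truncatedMean (marginalTail P l) (τ N)) atTop (𝓝 0)
  good : ∀ᶠ N in atTop, ∀ w x T : ℝ≥0, ε * a N ≤ w → w ≤ K₁ * a N → τ N ≤ K * T → T ≤ K * τ N →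
    (x : ℝ) ∉ S N → |(g (w * x / T) : ℝ) - (w * x / T : ℝ≥0)| ≤ δ * (w * x / T : ℝ≥0)

lemma mul_div_le_of_le {w x T a K₁ K η σ : ℝ} (hw0 : 0 ≤ w) (hw : w ≤ K₁ * a) (ha : 0 < a)
    (hK₁ : 0 < K₁) (hK : 0 < K) (hη : 0 < η) (hσ : 0 < σ) (hT : σ ≤ K * T)
    (hx : x ≤ η / (K₁ * K) * (σ / a)) : w * x / T ≤ η := by
  have hT0 : 0 < T := pos_of_mul_pos_right (hσ.trans_le hT) hK.le
  rw [div_le_iff₀ hT0]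
  calc w * x ≤ (K₁ * a) * (η / (K₁ * K) * (σ / a)) :=
        (mul_le_mul_of_nonneg_left hx hw0).trans (by gcongr)
    _ = η / K * σ := by field_simp
    _ ≤ η / K * (K * T) := by gcongr
    _ = η * T := by field_simp

lemma le_mul_div_of_le {w x T a ε K M σ : ℝ} (hw : ε * a ≤ w) (ha : 0 < a) (hε : 0 < ε)
    (hK : 0 < K) (hM : 0 < M) (hσ : 0 < σ) (hT0 : 0 < T) (hT : T ≤ K * σ)
    (hx : M * K / ε * (σ / a) ≤ x) : M ≤ w * x / T := by
  have hw0 : 0 ≤ w := (mul_pos hε ha).le.trans hw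
  rw [le_div_iff₀ hT0]
  calc M * T ≤ M * (K * σ) := by gcongr
    _ = ε * a * (M * K / ε * (σ / a)) := by field_simp
    _ ≤ w * x := by gcongr

lemma indicator_id_coe_nonneg (S : Set ℝ) (x : ℝ≥0) : 0 ≤ S.indicator id (x : ℝ) :=
  Set.indicator_apply_nonneg fun _ => x.coe_nonneg

lemma measurable_indicator_id_coord {S : Set ℝ} (hS : MeasurableSet S) (l : Fin L) :
    Measurable fun w : Cone L => S.indicator id (w l : ℝ) :=
  (measurable_id.indicator hS).comp (measurable_coord l)

section InfiniteMean

variable [IsFiniteMeasure P]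

lemma indicator_id_Icc_le {u v y : ℝ} (hv : 0 ≤ v) (hy : y < u) (w : Cone L) :
    (Set.Icc u v).indicator id (w l : ℝ) ≤ {w : Cone L | y < (w l : ℝ)}.indicator (fun _ => v) w :=
  Set.indicator_apply_le' (fun hw => hw.2.trans_eq
    (Set.indicator_of_mem (s := {w : Cone L | y < (w l : ℝ)}) (hy.trans_le hw.1) fun _ => v).symm)
    fun _ => Set.indicator_nonneg (fun _ _ => hv) w

lemma integrable_indicator_id_Icc (u v : ℝ) :
    Integrable (fun w => (Set.Icc u v).indicator id (w l : ℝ)) P :=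
  integrable_of_nonneg_of_le (M := max v 0) (measurable_indicator_id_coord measurableSet_Icc l)
    (fun w => indicator_id_coe_nonneg _ (w l)) fun _ => Set.indicator_apply_le'
      (fun hw => hw.2.trans (le_max_left _ _)) fun _ => le_max_right _ _

lemma integral_indicator_id_Icc_le {u v y : ℝ} (hv : 0 ≤ v) (hy : y < u) :
    ∫ w, (Set.Icc u v).indicator id (w l : ℝ) ∂P ≤ v * marginalTail P l y := by
  have hS := measurableSet_lt_coe_coord l y
  calc _ ≤ ∫ w, {w : Cone L | y < (w l : ℝ)}.indicator (fun _ => v) w ∂P :=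
        integral_mono (integrable_indicator_id_Icc u v) ((integrable_const _).indicator hS)
          (indicator_id_Icc_le hv hy)
    _ = v * marginalTail P l y := by
        rw [integral_indicator_const _ hS, smul_eq_mul, mul_comm, marginalTail]

lemma tendsto_integral_indicator_Icc_div (h : RegularlyVaryingTail (marginalTail P l) α)
    (hm : Tendsto (truncatedMean (marginalTail P l)) atTop atTop) (hτ : Tendsto τ atTop atTop)
    {a : ℕ → ℝ} (ha : Tendsto a atTop atTop) {ρ₁ ρ₂ : ℝ} (hρ₁ : 0 < ρ₁) (hρ₂ : 0 < ρ₂) :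
    Tendsto (fun N => (∫ w, (Set.Icc (ρ₁ * (τ N / a N)) (ρ₂ * (τ N / a N))).indicator id
      (w l : ℝ) ∂P) / truncatedMean (marginalTail P l) (τ N)) atTop (𝓝 0) := by
  have hpos : ∀ᶠ N in atTop, 0 < τ N ∧ 0 < a N :=
    (hτ.eventually_gt_atTop 0).and (ha.eventually_gt_atTop 0)
  refine tendsto_order.2 ⟨fun e he => hpos.mono fun N hN => he.trans_le (div_nonneg
    (integral_nonneg fun w => indicator_id_coe_nonneg _ (w l)) (h.truncatedMean_nonneg hN.1.le)),
    fun e he => ?_⟩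
  obtain ⟨k, Y, hkY⟩ :=
    h.exists_mul_le_truncatedMean hm (ε := e / 2 * (ρ₁ / (2 * ρ₂))) (by positivity)
  filter_upwards [hpos, hτ.eventually_ge_atTop Y, ha.eventually_ge_atTop (k * ρ₁ / 2)]
    with N ⟨hτ0, ha0⟩ hτY hak
  set y := ρ₁ / 2 * (τ N / a N) with hy
  have hyτ : k * y ≤ τ N := by
    calc k * (ρ₁ / 2 * (τ N / a N)) = k * ρ₁ / 2 * (τ N / a N) := by ring
      _ ≤ a N * (τ N / a N) := by gcongr
      _ = τ N := by field_simp
  have hyρ : y < ρ₁ * (τ N / a N) := by rw [hy]; gcongr; linarith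
  have hm0 := h.truncatedMean_pos hτ0
  rw [div_lt_iff₀ hm0]
  calc _ ≤ ρ₂ * (τ N / a N) * marginalTail P l y :=
        integral_indicator_id_Icc_le (by positivity) hyρ
    _ = 2 * ρ₂ / ρ₁ * (y * marginalTail P l y) := by rw [hy]; field_simp
    _ ≤ 2 * ρ₂ / ρ₁ * (e / 2 * (ρ₁ / (2 * ρ₂)) * truncatedMean (marginalTail P l) (τ N)) := by
        gcongr ?_ * ?_; exact hkY (τ N) y hτY (by positivity) hyτ
    _ = e / 2 * truncatedMean (marginalTail P l) (τ N) := by field_simp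
    _ < e * truncatedMean (marginalTail P l) (τ N) := by gcongr; linarith

-- For infinite mean the truncated mean varies slowly enough that weights comparable to `τ_N / a_N`,
-- where `w x / T` is neither small nor large, are negligible.
lemma exists_isWindow_of_infinite_mean (h : RegularlyVaryingTail (marginalTail P l) α)
    (hτ : Tendsto τ atTop atTop) (hm : Tendsto (truncatedMean (marginalTail P l)) atTop atTop)
    (hg : IsConnectionFunction g) (hg' : Tendsto (fun x => g x / x) atTop (𝓝 1)) {a : ℕ → ℝ}
    (ha : Tendsto a atTop atTop) {δ ε K₁ K : ℝ} (hδ : 0 < δ) (hε : 0 < ε) (hK₁ : 0 < K₁)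
    (hK : 0 < K) : ∃ S, IsWindow P l g a τ δ ε K₁ K S := by
  obtain ⟨η, hη, hgη⟩ := hg.exists_near_zero hδ
  obtain ⟨M, hM, hgM⟩ := exists_near_top hg' hδ
  refine ⟨fun N => Set.Icc (η / (K₁ * K) * (τ N / a N)) (M * K / ε * (τ N / a N)),
    fun _ => measurableSet_Icc, fun _ => integrable_indicator_id_Icc _ _,
    tendsto_integral_indicator_Icc_div h hm hτ ha (by positivity) (by positivity), ?_⟩
  filter_upwards [hτ.eventually_gt_atTop 0, ha.eventually_gt_atTop 0]
    with N hτ0 ha0 w x T hw₁ hw₂ hT₁ hT₂ hx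
  rcases lt_or_ge (x : ℝ) (η / (K₁ * K) * (τ N / a N)) with hlow | hhigh
  · refine hgη _ ?_
    push_cast
    exact mul_div_le_of_le w.coe_nonneg hw₂ ha0 hK₁ hK hη hτ0 hT₁ hlow.le
  · refine hgM _ ?_
    push_cast
    exact le_mul_div_of_le hw₁ ha0 hε hK hM hτ0 (pos_of_mul_pos_right (hτ0.trans_le hT₁) hK.le) hT₂
      (not_le.1 fun hle => hx ⟨hhigh, hle⟩).le

end InfiniteMean

section FiniteMean

lemma norm_indicator_id_coe_le (S : Set ℝ) (x : ℝ≥0) : ‖S.indicator id (x : ℝ)‖ ≤ x :=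
  (norm_indicator_le_norm_self _ _).trans_eq (Real.norm_of_nonneg x.coe_nonneg)

lemma tendsto_integral_indicator_Ici (hi : Integrable (fun w : Cone L => (w l : ℝ)) P) {u : ℕ → ℝ}
    (hu : Tendsto u atTop atTop) :
    Tendsto (fun N => ∫ w, (Set.Ici (u N)).indicator id (w l : ℝ) ∂P) atTop (𝓝 0) := by
  rw [← integral_zero (Cone L) ℝ (μ := P)]
  refine tendsto_integral_of_dominated_convergence (fun w => (w l : ℝ))
    (fun N => (measurable_indicator_id_coord measurableSet_Ici l).aestronglyMeasurable) hi
    (fun N => Eventually.of_forall fun w => norm_indicator_id_coe_le _ (w l))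
    (Eventually.of_forall fun w => tendsto_const_nhds.congr' ?_)
  filter_upwards [hu.eventually_gt_atTop (w l : ℝ)] with N hN
  exact (Set.indicator_of_notMem (fun hw => hN.not_ge hw) _).symm

lemma exists_isWindow_of_finite_mean (h : RegularlyVaryingTail (marginalTail P l) α)
    (hτ : Tendsto τ atTop atTop) (hi : Integrable (fun w : Cone L => (w l : ℝ)) P)
    (hg : IsConnectionFunction g) {a : ℕ → ℝ} (ha : Tendsto a atTop atTop)
    (hτa : Tendsto (fun N => τ N / a N) atTop atTop) {δ ε K₁ K : ℝ} (hδ : 0 < δ) (hK₁ : 0 < K₁)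
    (hK : 0 < K) : ∃ S, IsWindow P l g a τ δ ε K₁ K S := by
  obtain ⟨η, hη, hgη⟩ := hg.exists_near_zero hδ
  have hρ : 0 < η / (K₁ * K) := by positivity
  refine ⟨fun N => Set.Ici (η / (K₁ * K) * (τ N / a N)), fun _ => measurableSet_Ici,
    fun N => hi.mono' (measurable_indicator_id_coord measurableSet_Ici l).aestronglyMeasurable
      (Eventually.of_forall fun w => norm_indicator_id_coe_le _ (w l)), ?_, ?_⟩
  · have hlim := (tendsto_integral_indicator_Ici hi (hτa.const_mul_atTop hρ)).div_const
      (truncatedMean (marginalTail P l) 1)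
    rw [zero_div] at hlim
    have hnonneg : ∀ N, 0 ≤ ∫ w, (Set.Ici (η / (K₁ * K) * (τ N / a N))).indicator id (w l : ℝ) ∂P :=
      fun N => integral_nonneg fun w => indicator_id_coe_nonneg _ (w l)
    refine squeeze_zero' ?_ ?_ hlim
    · filter_upwards [hτ.eventually_ge_atTop 0] with N hN
      exact div_nonneg (hnonneg N) (h.truncatedMean_nonneg hN)
    · filter_upwards [hτ.eventually_ge_atTop 1] with N hN
      exact div_le_div_of_nonneg_left (hnonneg N) (h.truncatedMean_pos one_pos)
        (h.monotone_truncatedMean hN)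
  · filter_upwards [hτ.eventually_gt_atTop 0, ha.eventually_gt_atTop 0]
      with N hτ0 ha0 w x T _ hw₂ hT₁ _ hx
    refine hgη _ ?_
    push_cast
    exact mul_div_le_of_le w.coe_nonneg hw₂ ha0 hK₁ hK hη hτ0 hT₁ (not_le.1 hx).le

end FiniteMean

variable [IsProbabilityMeasure P]

lemma truncatedMean_le_integral (hi : Integrable (fun w : Cone L => (w l : ℝ)) P) {y : ℝ}
    (hy : 0 ≤ y) : truncatedMean (marginalTail P l) y ≤ ∫ w, (w l : ℝ) ∂P := by
  rw [← integral_min_coord hy]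
  exact integral_mono (integrable_min_coord hy) hi fun w => min_le_left _ _

lemma integrable_of_tendsto_truncatedMean (h : RegularlyVaryingTail (marginalTail P l) α) {M : ℝ}
    (hM : Tendsto (truncatedMean (marginalTail P l)) atTop (𝓝 M)) :
    Integrable (fun w : Cone L => (w l : ℝ)) P := by
  have hlim := lintegral_tendsto_of_tendsto_of_monotone (μ := P)
    (f := fun (k : ℕ) w => ENNReal.ofReal (min (w l : ℝ) k))
    (F := fun w => ENNReal.ofReal (w l : ℝ))
    (fun k => (measurable_min_coord l k).ennreal_ofReal.aemeasurable)
    (Eventually.of_forall fun w j k hjk => ENNReal.ofReal_le_ofReal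
      (min_le_min_left _ (Nat.cast_le.2 hjk)))
    (Eventually.of_forall fun w => by
      refine tendsto_const_nhds.congr' ?_
      filter_upwards [tendsto_natCast_atTop_atTop.eventually_ge_atTop (w l : ℝ)] with k hk
      rw [min_eq_left hk])
  have hle : ∀ k : ℕ, ∫⁻ w, ENNReal.ofReal (min (w l : ℝ) k) ∂P ≤ ENNReal.ofReal M := by
    intro k
    rw [← ofReal_integral_eq_lintegral_ofReal (integrable_min_coord k.cast_nonneg)
      (Eventually.of_forall (min_coord_nonneg l k.cast_nonneg)), integral_min_coord k.cast_nonneg]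
    exact ENNReal.ofReal_le_ofReal (h.monotone_truncatedMean.ge_of_tendsto hM k)
  exact (lintegral_ofReal_ne_top_iff_integrable (measurable_coord l).aestronglyMeasurable
    (Eventually.of_forall fun w => (w l).coe_nonneg)).1
    ((le_of_tendsto' hlim hle).trans_lt ENNReal.ofReal_lt_top).ne

lemma IsTailLevel.tendsto_sumScale_div {F : ℝ → ℝ} (h : RegularlyVaryingTail F α)
    (hτ : IsSumScale F τ) {t : ℕ → ℕ} (ht : ∀ᶠ N in atTop, 1 ≤ t N) {a : ℕ → ℝ}
    (ha : IsTailLevel F (fun N => N / t N) a) {M : ℝ}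
    (hM : Tendsto (truncatedMean F) atTop (𝓝 M)) : Tendsto (fun N => τ N / a N) atTop atTop := by
  have hm := h.truncatedMean_pos one_pos
  refine tendsto_atTop_mono' _ ?_ ((ha.tendsto_div_atTop h hM).const_mul_atTop hm)
  filter_upwards [ha.tendsto_atTop.eventually_gt_atTop 0, ht, hτ.eventually_mul_le h]
    with N ha0 ht1 hτN
  rw [mul_div_assoc']
  gcongr
  calc truncatedMean F 1 * (N / t N) ≤ truncatedMean F 1 * N := by
        gcongr; exact div_le_self N.cast_nonneg (Nat.one_le_cast.2 ht1)
    _ ≤ τ N := by rwa [mul_comm]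

lemma exists_isWindow (h : RegularlyVaryingTail (marginalTail P l) α)
    (hτ : IsSumScale (marginalTail P l) τ) (hg : IsConnectionFunction g)
    (hmean : Integrable (fun w : Cone L => (w l : ℝ)) P ∨ Tendsto (fun x => g x / x) atTop (𝓝 1))
    {t : ℕ → ℕ} (ht : ∀ᶠ N in atTop, 1 ≤ t N) {a : ℕ → ℝ}
    (ha : IsTailLevel (marginalTail P l) (fun N => N / t N) a)
    {δ ε K₁ K : ℝ} (hδ : 0 < δ) (hε : 0 < ε) (hK₁ : 0 < K₁) (hK : 0 < K) :
    ∃ S, IsWindow P l g a τ δ ε K₁ K S := by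
  rcases h.truncatedMean_tendsto_atTop_or with hm | ⟨M, -, hM⟩
  · refine exists_isWindow_of_infinite_mean h (hτ.tendsto_atTop h) hm hg
      (hmean.resolve_left fun hi => ?_) ha.tendsto_atTop hδ hε hK₁ hK
    obtain ⟨y, hy, hy0⟩ := ((hm.eventually_gt_atTop (∫ w, (w l : ℝ) ∂P)).and
      (eventually_ge_atTop 0)).exists
    exact (truncatedMean_le_integral hi hy0).not_gt hy
  · exact exists_isWindow_of_finite_mean h (hτ.tendsto_atTop h)
      (integrable_of_tendsto_truncatedMean h hM) hg ha.tendsto_atTop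
      (ha.tendsto_sumScale_div h hτ ht hM) hδ hK₁ hK

end Window

section MeanDegree

open RegularlyVaryingTail

lemma abs_sub_le_add_indicator {g : ℝ≥0 → ℝ≥0} {C w x T : ℝ≥0} {S : Set ℝ} {δ : ℝ} (hδ : 0 ≤ δ)
    (hC : ∀ z, g z ≤ C * z) (hgood : (x : ℝ) ∉ S →
      |(g (w * x / T) : ℝ) - (w * x / T : ℝ≥0)| ≤ δ * (w * x / T : ℝ≥0)) :
    |(g (w * x / T) : ℝ) - (w * x / T : ℝ≥0)| ≤
      δ * (w * x / T) + (C + 1) * (w * S.indicator id (x : ℝ) / T) := by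
  have hz : ((w * x / T : ℝ≥0) : ℝ) = w * x / T := by push_cast; rfl
  by_cases hx : (x : ℝ) ∈ S
  · have hg : (g (w * x / T) : ℝ) ≤ C * (w * x / T) := by exact_mod_cast hC (w * x / T)
    have hz0 : (0 : ℝ) ≤ w * x / T := by positivity
    have hδz := mul_nonneg hδ hz0
    rw [Set.indicator_of_mem hx, id, hz, add_mul, one_mul, abs_le]
    constructor <;> linarith [(g (w * x / T)).coe_nonneg]
  · simpa [Set.indicator_of_notMem hx, hz] using hgood hx

variable {Ω : Type*} {L : ℕ} {g : Fin L → ℝ≥0 → ℝ≥0} {W : ℕ → Ω → Cone L} {l : Fin L}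

lemma abs_meanDegree_sub_le {N : ℕ} {ω : Ω} {S : Set ℝ} {δ : ℝ} {C : ℝ≥0} (hδ : 0 ≤ δ)
    (hC : ∀ z, g l z ≤ C * z) (i : Fin N) (hT : 0 < totalWeight W N l ω)
    (hgood : ∀ j : Fin N, (W j ω l : ℝ) ∉ S →
      |(edgeRate g W N i j l ω : ℝ) - (W i ω l * W j ω l / totalWeight W N l ω : ℝ≥0)| ≤
        δ * (W i ω l * W j ω l / totalWeight W N l ω : ℝ≥0)) :
    |(meanDegree g W N i l ω : ℝ) - W i ω l| ≤ W i ω l *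
      (δ + (C + 1) * ((∑ j : Fin N, S.indicator id (W j ω l : ℝ)) / totalWeight W N l ω)) := by
  set T := totalWeight W N l ω
  have hT0 : (T : ℝ) ≠ 0 := (NNReal.coe_pos.2 hT).ne'
  have hsum : ∑ j : Fin N, (W i ω l * W j ω l / T : ℝ) = W i ω l := by
    rw [← Finset.sum_div, ← Finset.mul_sum, ← coe_totalWeight, mul_div_cancel_right₀ _ hT0]
  calc |(meanDegree g W N i l ω : ℝ) - W i ω l|
      = |∑ j : Fin N, ((edgeRate g W N i j l ω : ℝ) - (W i ω l * W j ω l / T : ℝ≥0))| := by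
        rw [Finset.sum_sub_distrib]; push_cast; rw [hsum]; simp [meanDegree]
    _ ≤ ∑ j : Fin N, (δ * (W i ω l * W j ω l / T) +
          (C + 1) * (W i ω l * S.indicator id (W j ω l : ℝ) / T)) :=
        (Finset.abs_sum_le_sum_abs _ _).trans
          (Finset.sum_le_sum fun j _ => abs_sub_le_add_indicator hδ hC (hgood j))
    _ = _ := by
        rw [Finset.sum_add_distrib, ← Finset.mul_sum, ← Finset.mul_sum, hsum, ← Finset.sum_div,
          ← Finset.mul_sum]
        ring

variable {τ a : ℕ → ℝ}

lemma IsWindow.eventually_abs_meanDegree_sub_le {P : Measure (Cone L)} {C : ℝ≥0}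
    {δ ε K₁ K : ℝ} {S : ℕ → Set ℝ} (hS : IsWindow P l (g l) a τ (δ / 2) ε K₁ K S) (hδ : 0 < δ)
    (hK : 0 < K) (hτ : ∀ᶠ N in atTop, 0 < τ N) (hC : ∀ z, g l z ≤ C * z) :
    ∀ᶠ N in atTop, ∀ ω,
      τ N ≤ K * totalWeight W N l ω → totalWeight W N l ω ≤ K * τ N →
      ∑ i : Fin N, (S N).indicator id (W i ω l : ℝ) < δ / 2 / ((C + 1) * K) * τ N →
      ∀ i : Fin N, ε * a N ≤ W i ω l → W i ω l ≤ K₁ * a N →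
        |(meanDegree g W N i l ω : ℝ) - W i ω l| ≤ δ * W i ω l := by
  filter_upwards [hτ, hS.good] with N hτ0 hgood ω hT₁ hT₂ hsum i hi₁ hi₂
  have hT0 : (0 : ℝ) < totalWeight W N l ω := pos_of_mul_pos_right (hτ0.trans_le hT₁) hK.le
  have hratio : (∑ j : Fin N, (S N).indicator id (W j ω l : ℝ)) / totalWeight W N l ω ≤
      δ / 2 / ((C + 1) * K) * K := by
    rw [div_le_iff₀ hT0, mul_assoc]
    exact hsum.le.trans (by gcongr)
  calc _ ≤ W i ω l * (δ / 2 + (C + 1) * _) :=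
        abs_meanDegree_sub_le (half_pos hδ).le hC i (NNReal.coe_pos.1 hT0) fun j hj =>
          hgood (W i ω l) (W j ω l) (totalWeight W N l ω) hi₁ hi₂ hT₁ hT₂ hj
    _ ≤ W i ω l * (δ / 2 + (C + 1) * (δ / 2 / ((C + 1) * K) * K)) := by gcongr
    _ = δ * W i ω l := by field_simp; ring

variable [MeasurableSpace Ω] {μ : Measure Ω} {α : ℝ}

lemma IsWindow.whp_sum_le {g : ℝ≥0 → ℝ≥0} {δ ε K₁ K κ : ℝ} {S : ℕ → Set ℝ}
    (hS : IsWindow (μ.map (W 0)) l g a τ δ ε K₁ K S) (hW : ∀ i, IdentDistrib (W i) (W 0) μ μ)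
    (hτ : IsSumScale (marginalTail (μ.map (W 0)) l) τ) (hκ : 0 < κ) :
    Whp μ fun N ω => ∑ i : Fin N, (S N).indicator id (W i ω l : ℝ) < κ * τ N := by
  have hlim := hS.mass.div_const κ
  rw [zero_div] at hlim
  refine .of_eventually_le hlim ?_
  filter_upwards [hτ.one_le, hτ.balance] with N hone hbal
  have hτ0 : 0 < τ N := one_pos.trans_le hone
  simp only [not_lt]
  refine (measureReal_le_sum_comp hW (measurable_indicator_id_coord (hS.measurable N) l)
    (hS.integrable N) (fun w => indicator_id_coe_nonneg _ (w l)) N (mul_pos hκ hτ0)).trans_eq ?_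
  have hN : (N : ℝ) ≠ 0 := fun h0 => hτ0.ne' (by rw [← hbal, h0, zero_mul])
  rw [div_div, ← mul_div_mul_left (∫ w, (S N).indicator id (w l : ℝ) ∂(μ.map (W 0))) _ hN,
    ← mul_assoc _ _ κ, hbal, mul_comm κ]

theorem whp_abs_meanDegree_sub_le [IsProbabilityMeasure μ] (hindep : iIndepFun W μ)
    (hW : ∀ i, IdentDistrib (W i) (W 0) μ μ)
    (h : RegularlyVaryingTail (marginalTail (μ.map (W 0)) l) α) (hg : IsConnectionFunction (g l))
    (hmean : Integrable (fun w : Cone L => (w l : ℝ)) (μ.map (W 0)) ∨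
      Tendsto (fun x => g l x / x) atTop (𝓝 1))
    {t : ℕ → ℕ} (ht : ∀ᶠ N in atTop, 1 ≤ t N)
    (ha : IsTailLevel (marginalTail (μ.map (W 0)) l) (fun N => N / t N) a)
    {δ ε K₁ : ℝ} (hδ : 0 < δ) (hε : 0 < ε) (hK₁ : 0 < K₁) :
    Whp μ fun N ω => ∀ i : Fin N, ε * a N ≤ W i ω l → W i ω l ≤ K₁ * a N →
      |(meanDegree g W N i l ω : ℝ) - W i ω l| ≤ δ * W i ω l := by
  have := Measure.isProbabilityMeasure_map (hW 0).aemeasurable_fst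
  obtain ⟨τ, hτ⟩ := h.exists_isSumScale
  obtain ⟨C, hC⟩ := hg.linear_bound
  refine .of_forall_eventually_le fun η hη => ?_
  obtain ⟨K, hK, htight⟩ := exists_totalWeight_tight hindep hW h hτ (half_pos hη)
  obtain ⟨S, hS⟩ := exists_isWindow h hτ hg hmean ht ha (half_pos hδ) hε hK₁ hK
  have hsum := hS.whp_sum_le hW hτ (show 0 < δ / 2 / ((C + 1) * K) by positivity)
  have hnear := hS.eventually_abs_meanDegree_sub_le (g := g) (W := W) hδ hK
    ((hτ.tendsto_atTop h).eventually_gt_atTop 0) hC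
  filter_upwards [htight, hsum.eventually (gt_mem_nhds (half_pos hη)), hnear]
    with N htightN hsumN hnearN
  refine (measureReal_mono fun ω hω => ?_).trans
    ((measureReal_union_le _ _).trans ((add_le_add htightN hsumN.le).trans_eq (add_halves η)))
  by_contra hout
  simp only [Set.mem_union, Set.mem_ofPred_eq, not_or, not_not] at hout
  exact hω (hnearN ω hout.1.1 hout.1.2 hout.2)

end MeanDegree

/-! ### Counting exceptional nodes -/

section Count

variable {ι : Type*} {p q r : ι → Prop}

/-- The number of indices with a given property, as a real number. -/
noncomputable def count (p : ι → Prop) : ℝ := {i | p i}.ncard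

lemma count_eq_card [Fintype ι] [DecidablePred p] :
    count p = (Finset.univ.filter p).card := by
  rw [count, Set.ncard_eq_toFinset_card']
  simp

lemma count_true (N : ℕ) : count (fun _ : Fin N => True) = N := by
  simp [count]

lemma count_mem_eq_sum [Fintype ι] {β : Type*} (z : ι → β) (S : ι → Set β) :
    count (fun i => z i ∈ S i) = ∑ i, (S i).indicator (1 : β → ℝ) (z i) := by
  classical
  rw [count_eq_card, Finset.card_filter]
  push_cast
  exact Finset.sum_congr rfl fun i _ => by simp [Set.indicator_apply]

variable [Finite ι]

lemma count_mono (h : ∀ i, p i → q i) : count p ≤ count q :=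
  Nat.cast_le.2 (Set.ncard_le_ncard (fun i hi => h i hi) (Set.toFinite _))

lemma count_le_add (h : ∀ i, p i → q i ∨ r i) : count p ≤ count q + count r := by
  have hunion := (Set.ncard_le_ncard (fun i hi => h i hi) (Set.toFinite _)).trans
    (Set.ncard_union_le {i | q i} {i | r i})
  unfold count
  exact_mod_cast hunion

lemma count_and_not (h : ∀ i, q i → p i) : count (fun i => p i ∧ ¬ q i) = count p - count q := by
  have hdiff := Set.ncard_sdiff_add_ncard_of_subset (fun i (hi : q i) => h i hi)
    (Set.toFinite {i | p i})
  rw [eq_sub_iff_add_eq]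
  unfold count
  exact_mod_cast hdiff

lemma abs_count_sub_le : |count p - count q| ≤ count fun i => ¬ (p i ↔ q i) := by
  have hp : count p ≤ count q + count fun i => ¬ (p i ↔ q i) := count_le_add fun i hi => by tauto
  have hq : count q ≤ count p + count fun i => ¬ (p i ↔ q i) := count_le_add fun i hi => by tauto
  rw [abs_le]
  constructor <;> linarith

end Count

lemma abs_div_sub_le {x y T lam e : ℝ} (hT : 0 < T) (he : e ≤ 1 / 2)
    (hx : |x - lam * T| ≤ e * T) (hy : |y - 1 * T| ≤ e * T) :
    |x / y - lam| ≤ 2 * e * (1 + |lam|) := by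
  have hyT : T / 2 ≤ y := by nlinarith [(abs_le.1 hy).1]
  have hy0 : 0 < y := by linarith
  have he0 : 0 ≤ e := nonneg_of_mul_nonneg_left ((abs_nonneg _).trans hx) hT
  rw [show x / y - lam = (x - lam * T - lam * (y - 1 * T)) / y by field_simp; ring, abs_div,
    abs_of_pos hy0, div_le_iff₀ hy0]
  calc |x - lam * T - lam * (y - 1 * T)| ≤ |x - lam * T| + |lam * (y - 1 * T)| := abs_sub _ _
    _ ≤ e * T + |lam| * (e * T) := by rw [abs_mul]; gcongr
    _ = 2 * e * (1 + |lam|) * (T / 2) := by ring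
    _ ≤ 2 * e * (1 + |lam|) * y := by gcongr

section CountTendsto

variable {Ω : Type*} [MeasurableSpace Ω] {μ : Measure Ω} {t : ℕ → ℕ}
  {p q r : (N : ℕ) → Fin N → Ω → Prop} {u v : ℝ}

/-- Convergence in probability of `t N`⁻¹ times the number of nodes with property `p` to `v`,
stated without the division. -/
def CountTendsto (μ : Measure Ω) (t : ℕ → ℕ) (p : (N : ℕ) → Fin N → Ω → Prop) (v : ℝ) : Prop :=
  ∀ ⦃ε : ℝ⦄, 0 < ε → Whp μ fun N ω => |count (fun i => p N i ω) - v * t N| ≤ ε * t N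

/-- In probability, only `o(t N)` nodes have property `p`. -/
def Negligible (μ : Measure Ω) (t : ℕ → ℕ) (p : (N : ℕ) → Fin N → Ω → Prop) : Prop :=
  ∀ ⦃ε : ℝ⦄, 0 < ε → Whp μ fun N ω => count (fun i => p N i ω) ≤ ε * t N

lemma CountTendsto.of_tendsto_mul_measureReal [IsProbabilityMeasure μ] {E : Type*}
    [MeasurableSpace E] {X : ℕ → Ω → E} (hindep : iIndepFun X μ)
    (hX : ∀ i, IdentDistrib (X i) (X 0) μ μ) (ht : Tendsto t atTop atTop)
    {S : ℕ → Set E} (hS : ∀ N, MeasurableSet (S N))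
    (hv : Tendsto (fun N : ℕ => N / t N * (μ.map (X 0)).real (S N)) atTop (𝓝 v)) :
    CountTendsto μ t (fun N i ω => X i ω ∈ S N) v := fun ε hε => by
  simp only [count_mem_eq_sum]
  exact whp_sum_indicator_near hindep hX (tendsto_natCast_atTop_atTop.comp ht) hS hv hε

variable [IsFiniteMeasure μ]

lemma Negligible.of_imp_or (hp : Negligible μ t p) (hq : Negligible μ t q)
    (h : ∀ N i ω, r N i ω → p N i ω ∨ q N i ω) : Negligible μ t r := fun ε hε =>
  ((hp (half_pos hε)).and (hq (half_pos hε))).mono (Eventually.of_forall fun N ω hω =>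
    (count_le_add fun i => h N i ω).trans (by linarith [hω.1, hω.2]))

lemma CountTendsto.congr (hp : CountTendsto μ t p v)
    (h : Negligible μ t fun N i ω => ¬ (p N i ω ↔ q N i ω)) : CountTendsto μ t q v :=
  fun ε hε => by
    refine ((hp (half_pos hε)).and (h (half_pos hε))).mono
      (Eventually.of_forall fun N ω ⟨hcount, hdiff⟩ => ?_)
    have hpq := (abs_count_sub_le (p := fun i => p N i ω) (q := fun i => q N i ω)).trans hdiff
    calc _ ≤ |count (fun i => q N i ω) - count (fun i => p N i ω)| + _ := abs_sub_le _ _ _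
      _ ≤ ε / 2 * t N + ε / 2 * t N := add_le_add (by rwa [abs_sub_comm]) hcount
      _ = ε * t N := by ring

lemma CountTendsto.and_not (hp : CountTendsto μ t p v) (hq : CountTendsto μ t q u)
    (h : ∀ᶠ N in atTop, ∀ i ω, q N i ω → p N i ω) :
    CountTendsto μ t (fun N i ω => p N i ω ∧ ¬ q N i ω) (v - u) := fun ε hε => by
  refine ((hp (half_pos hε)).and (hq (half_pos hε))).mono ?_
  filter_upwards [h] with N hN ω hω
  rw [count_and_not fun i => hN i ω]
  calc _ = |(count (fun i => p N i ω) - v * t N) - (count (fun i => q N i ω) - u * t N)| := by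
        ring_nf
    _ ≤ ε / 2 * t N + ε / 2 * t N := (abs_sub _ _).trans (add_le_add hω.1 hω.2)
    _ = ε * t N := by ring

lemma CountTendsto.whp_le (hp : CountTendsto μ t p v) {c : ℝ} (hc : v < c) :
    Whp μ fun N ω => count (fun i => p N i ω) ≤ c * t N :=
  (hp (sub_pos.2 hc)).mono (Eventually.of_forall fun N ω hω => by linarith [(abs_le.1 hω).2])

lemma CountTendsto.whp_lt (hp : CountTendsto μ t p v) (ht : ∀ᶠ N in atTop, 0 < t N) {c : ℝ}
    (hc : c < v) : Whp μ fun N ω => c * t N < count (fun i => p N i ω) := by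
  refine (hp (half_pos (sub_pos.2 hc))).mono ?_
  filter_upwards [ht] with N hN ω hω
  have hgap := mul_pos (half_pos (sub_pos.2 hc)) (Nat.cast_pos.2 hN)
  linarith [(abs_le.1 hω).1]

theorem CountTendsto.tendstoInMeasure_div (hp : CountTendsto μ t p v)
    (hq : CountTendsto μ t q 1) (ht : ∀ᶠ N in atTop, 0 < t N) :
    TendstoInMeasure μ (fun N ω => count (fun i => p N i ω) / count (fun i => q N i ω)) atTop
      fun _ => v := by
  rw [tendstoInMeasure_iff_measureReal_dist]
  intro ε hε
  have hv : 0 < 2 * (1 + |v|) := by positivity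
  obtain ⟨e, he0, he⟩ := exists_between (lt_min (half_pos one_pos) (div_pos hε hv))
  have hnear : Whp μ fun N ω =>
      dist (count (fun i => p N i ω) / count (fun i => q N i ω)) v < ε := by
    refine ((hp he0).and (hq he0)).mono ?_
    filter_upwards [ht] with N hN ω hω
    have hsub := abs_div_sub_le (Nat.cast_pos.2 hN) (he.le.trans (min_le_left _ _)) hω.1 hω.2
    refine hsub.trans_lt ?_
    linarith [(lt_div_iff₀ hv).1 (he.trans_le (min_le_right _ _))]
  simpa only [Whp, not_lt] using hnear

lemma Negligible.of_measureReal_le {E : (N : ℕ) → Fin N → Set Ω}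
    (hE : ∀ N i, MeasurableSet (E N i)) (ht : ∀ᶠ N in atTop, 0 < t N) {b : ℕ → ℝ}
    (hb : ∀ N i, μ.real (E N i) ≤ b N)
    (hlim : Tendsto (fun N : ℕ => N / t N * b N) atTop (𝓝 0)) :
    Negligible μ t fun N i ω => ω ∈ E N i := fun ε hε => by
  have hdiv := hlim.div_const ε
  rw [zero_div] at hdiv
  refine .of_eventually_le hdiv ?_
  filter_upwards [ht] with N hN
  have htN : (0 : ℝ) < t N := Nat.cast_pos.2 hN
  have h_int : ∀ i, Integrable ((E N i).indicator (1 : Ω → ℝ)) μ := fun i =>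
    (integrable_const (1 : ℝ)).indicator (hE N i)
  have hmarkov := mul_meas_ge_le_integral_of_nonneg (μ := μ)
    (f := fun ω => ∑ i, (E N i).indicator (1 : Ω → ℝ) ω)
    (Eventually.of_forall fun ω => Finset.sum_nonneg fun i _ =>
      Set.indicator_nonneg (fun _ _ => zero_le_one) ω)
    (integrable_finsetSum _ fun i _ => h_int i) (ε * t N)
  rw [integral_finsetSum _ fun i _ => h_int i] at hmarkov
  simp only [integral_indicator_one (hE N _), count_mem_eq_sum (fun _ => _) (E N), not_le]
    at hmarkov ⊢
  have hsum : ∑ i, μ.real (E N i) ≤ N * b N :=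
    (Finset.sum_le_sum fun i _ => hb N i).trans_eq (by simp)
  calc μ.real {ω | ε * t N < ∑ i, (E N i).indicator 1 ω}
      ≤ μ.real {ω | ε * t N ≤ ∑ i, (E N i).indicator 1 ω} :=
        measureReal_mono fun ω hω => Set.mem_ofPred.2 (Set.mem_ofPred.1 hω).le
    _ ≤ N * b N / (ε * t N) := by
        rw [le_div_iff₀' (mul_pos hε htN)]
        exact hmarkov.trans hsum
    _ = N / t N * b N / ε := by field_simp

end CountTendsto

/-! ### Comparison of degrees and weights -/

section Mismatch

variable {Ω : Type*} [MeasurableSpace Ω] {μ : Measure Ω} {L : ℕ} {g : Fin L → ℝ≥0 → ℝ≥0}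
  {W : ℕ → Ω → Cone L} {A : (N : ℕ) → Fin N → Fin N → Fin L → Ω → ℕ} {l : Fin L}
  {t : ℕ → ℕ} {a : ℕ → ℝ} {α : ℝ}

/-- The tail empirical distribution of the array `Z`, rescaled by `a` and normalized by `t`,
converges in probability to the Pareto tail `y ↦ y ^ (-α)`. -/
def TailCountTendsto (μ : Measure Ω) (t : ℕ → ℕ) (a : ℕ → ℝ) (α : ℝ)
    (Z : (N : ℕ) → Fin N → Ω → ℝ) : Prop :=
  ∀ ⦃y : ℝ⦄, 0 < y → CountTendsto μ t (fun N i ω => y * a N < Z N i ω) (y ^ (-α))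

lemma IsMIRG.integrable_coord (hG : IsMIRG μ g W A) (hfin : ∫⁻ ω, (W 0 ω l : ℝ≥0∞) ∂μ < ∞) :
    Integrable (fun w : Cone L => (w l : ℝ)) (μ.map (W 0)) := by
  refine (lintegral_ofReal_ne_top_iff_integrable (measurable_coord l).aestronglyMeasurable
    (Eventually.of_forall fun w => (w l).coe_nonneg)).1 ?_
  simp only [ENNReal.ofReal_coe_nnreal]
  have hcoord : Measurable fun w : Cone L => (w l : ℝ≥0∞) :=
    measurable_coe_nnreal_ennreal.comp (measurable_pi_apply l)
  rw [lintegral_map hcoord (hG.measurable_weight 0)]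
  exact hfin.ne

lemma exists_rpow_sub_rpow_lt (p : ℝ) {v ε : ℝ} (hv : v ≠ 0) (hε : 0 < ε) :
    ∃ δ : ℝ, 0 < δ ∧ δ < 1 ∧ ((1 - δ) * v) ^ p - ((1 + δ) * v) ^ p < ε := by
  have hcont : ContinuousAt (fun δ : ℝ => ((1 - δ) * v) ^ p - ((1 + δ) * v) ^ p) 0 :=
    ((continuousAt_const.sub continuousAt_id).mul continuousAt_const |>.rpow_const
      (by simp [hv])).sub
      ((continuousAt_const.add continuousAt_id).mul continuousAt_const |>.rpow_const
        (by simp [hv]))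
  have hsmall : ∀ᶠ δ : ℝ in 𝓝 0, ((1 - δ) * v) ^ p - ((1 + δ) * v) ^ p < ε :=
    hcont.eventually (gt_mem_nhds (by simpa using hε))
  obtain ⟨δ, ⟨hδ, hδ1⟩, hδ0⟩ := (((hsmall.and (gt_mem_nhds one_pos)).filter_mono
    (nhdsWithin_le_nhds (s := Set.Ioi 0))).and self_mem_nhdsWithin).exists
  exact ⟨δ, hδ0, hδ1, hδ⟩

lemma TailCountTendsto.exists_whp_gap_le [IsFiniteMeasure μ] {Z : (N : ℕ) → Fin N → Ω → ℝ}
    (hZ : TailCountTendsto μ t a α Z) (ha : ∀ᶠ N in atTop, 0 < a N) {x ε : ℝ} (hx : 0 < x)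
    (hε : 0 < ε) : ∃ δ : ℝ, 0 < δ ∧ δ < 1 ∧ Whp μ fun N ω => count (fun i =>
      (1 - δ) * (x * a N) < Z N i ω ∧ ¬ (1 + δ) * (x * a N) < Z N i ω) ≤ ε * t N := by
  obtain ⟨δ, hδ0, hδ1, hδ⟩ := exists_rpow_sub_rpow_lt (-α) hx.ne' hε
  have hlow := hZ (mul_pos (sub_pos.2 hδ1) hx)
  have hhigh := hZ (mul_pos (show 0 < 1 + δ by positivity) hx)
  refine ⟨δ, hδ0, hδ1, ?_⟩
  simp only [← mul_assoc]
  refine (hlow.and_not hhigh ?_).whp_le hδ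
  filter_upwards [ha] with N hN i ω hi
  have hxa := mul_pos hx hN
  nlinarith

lemma TailCountTendsto.exists_whp_top_le [IsFiniteMeasure μ] {Z : (N : ℕ) → Fin N → Ω → ℝ}
    (hZ : TailCountTendsto μ t a α Z) (hα : 0 < α) {x ε : ℝ} (hx : 0 < x) (hε : 0 < ε) :
    ∃ K : ℝ, 1 ≤ K ∧ Whp μ fun N ω =>
      count (fun i => K * (x * a N) < Z N i ω) ≤ ε * t N := by
  have hlim : Tendsto (fun K : ℝ => (K * x) ^ (-α)) atTop (𝓝 0) :=
    (tendsto_rpow_neg_atTop hα).comp (tendsto_id.atTop_mul_const hx)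
  obtain ⟨K, hK, hK1⟩ := ((hlim.eventually (gt_mem_nhds hε)).and (eventually_ge_atTop 1)).exists
  refine ⟨K, hK1, ?_⟩
  simp only [← mul_assoc]
  exact (hZ (mul_pos (one_pos.trans_le hK1) hx)).whp_le hK

lemma tailCountTendsto_weight [IsProbabilityMeasure μ] (hindep : iIndepFun W μ)
    (hW : ∀ i, IdentDistrib (W i) (W 0) μ μ)
    (h : RegularlyVaryingTail (marginalTail (μ.map (W 0)) l) α) (ht : Tendsto t atTop atTop)
    (ha : IsTailLevel (marginalTail (μ.map (W 0)) l) (fun N => N / t N) a) :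
    TailCountTendsto μ t a α fun _ i ω => W i ω l := fun x hx =>
  .of_tendsto_mul_measureReal hindep hW ht (S := fun N => {w | x * a N < w l})
    (fun _ => measurableSet_lt_coe_coord l _) (ha.tendsto_mul_rpow h hx)

lemma IsTailLevel.tendsto_mul_exp_chernoff {F : ℝ → ℝ} {n : ℕ → ℝ} (ha : IsTailLevel F n a)
    (h : RegularlyVaryingTail F α) {x ρ : ℝ} (hx : 0 < x) (hρ : 0 < ρ) (hρ1 : ρ ≠ 1) :
    Tendsto (fun N => n N * Real.exp (-(ρ - 1 - Real.log ρ) * (x * a N))) atTop (𝓝 0) := by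
  have hrate : 0 < ρ - 1 - Real.log ρ := sub_pos.2 (Real.log_lt_sub_one_of_pos hρ hρ1)
  simpa only [← mul_assoc, neg_mul] using ha.tendsto_mul_exp h (mul_pos hrate hx)

/-- Here `w` stands for the weight, `M` for the conditional mean degree and `D` for the degree of a
node. -/
lemma mismatch_cases {M w D y C δ K : ℝ} (hδ : 0 < δ) (hδ1 : δ < 1) (hK : 1 ≤ K) (hC : 0 ≤ C)
    (hy : 0 < y) (hM : M ≤ C * w)
    (hnear : (1 - δ / 2) / (C + 1) * y ≤ w → w ≤ K * y → |M - w| ≤ δ / 4 * w)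
    (hne : ¬ (y < w ↔ y < D)) :
    ((1 - δ) * y < w ∧ ¬ (1 + δ) * y < w) ∨ K * y < w ∨
      (M ≤ (1 - δ / 2) * y ∧ y ≤ D) ∨ ((1 + δ / 2) * y ≤ M ∧ D ≤ y) := by
  have hδy := mul_pos hδ hy
  have hδδy := mul_pos hδ (mul_pos (sub_pos.2 hδ1) hy)
  have hy1 : y ≤ K * y := le_mul_of_one_le_left hy.le hK
  set c := (1 - δ / 2) / (C + 1)
  have hcC : c * (C + 1) = 1 - δ / 2 := div_mul_cancel₀ _ (by positivity)
  have hc : 0 < c := div_pos (by linarith) (by positivity)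
  rcases le_or_gt w ((1 - δ) * y) with hsmall | hsmall
  · have hD : y < D := by
      by_contra hD
      exact hne ⟨fun hw => absurd hw (by linarith), fun hD' => absurd hD' hD⟩
    refine .inr (.inr (.inl ⟨?_, hD.le⟩))
    rcases le_or_gt (c * y) w with hcw | hcw
    · have hMw := (abs_le.1 (hnear hcw (by linarith))).2
      nlinarith
    · have hCw := mul_le_mul_of_nonneg_left hcw.le hC
      have hcy := mul_pos hc hy
      rw [← hcC]
      linarith
  rcases le_or_gt w ((1 + δ) * y) with hmid | hlarge
  · exact .inl ⟨hsmall, hmid.not_gt⟩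
  rcases lt_or_ge (K * y) w with htop | htop
  · exact .inr (.inl htop)
  · have hD : ¬ y < D := fun hD => hne ⟨fun _ => hD, fun _ => by linarith⟩
    have hc1 : c * y ≤ 1 * y := by
      gcongr
      nlinarith [mul_nonneg hc.le hC]
    have hMw := (abs_le.1 (hnear (by linarith) htop)).1
    exact .inr (.inr (.inr ⟨by nlinarith, not_lt.1 hD⟩))

variable [IsProbabilityMeasure μ]

lemma IsMIRG.negligible_meanDegree_le_degree_ge (hG : IsMIRG μ g W A)
    (h : RegularlyVaryingTail (marginalTail (μ.map (W 0)) l) α) (ht : ∀ᶠ N in atTop, 0 < t N)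
    (ha : IsTailLevel (marginalTail (μ.map (W 0)) l) (fun N => N / t N) a) {x ρ : ℝ} (hx : 0 < x)
    (hρ : 0 < ρ) (hρ1 : ρ < 1) : Negligible μ t fun N i ω =>
      (meanDegree g W N i l ω : ℝ) ≤ ρ * (x * a N) ∧ x * a N ≤ degree A N i l ω := by
  refine .of_measureReal_le (E := fun N i => {ω |
    (meanDegree g W N i l ω : ℝ) ≤ ρ * (x * a N) ∧ x * a N ≤ degree A N i l ω})
    (fun N i => ?_) ht (fun N i => ENNReal.toReal_le_of_le_ofReal (Real.exp_pos _).le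
      (hG.measure_meanDegree_le_degree_ge i l hρ hρ1.le (x * a N)))
    (ha.tendsto_mul_exp_chernoff h hx hρ hρ1.ne)
  have hcast : Measurable ((↑) : ℕ → ℝ) := measurable_from_top
  exact (measurableSet_le (hG.measurable_meanDegree i l).coe_nnreal_real measurable_const).inter
    (measurableSet_le measurable_const (hcast.comp (hG.measurable_degree i l)))

lemma IsMIRG.negligible_meanDegree_ge_degree_le (hG : IsMIRG μ g W A)
    (h : RegularlyVaryingTail (marginalTail (μ.map (W 0)) l) α) (ht : ∀ᶠ N in atTop, 0 < t N)
    (ha : IsTailLevel (marginalTail (μ.map (W 0)) l) (fun N => N / t N) a) {x ρ : ℝ} (hx : 0 < x)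
    (hρ1 : 1 < ρ) : Negligible μ t fun N i ω =>
      ρ * (x * a N) ≤ meanDegree g W N i l ω ∧ (degree A N i l ω : ℝ) ≤ x * a N := by
  refine .of_measureReal_le (E := fun N i => {ω |
    ρ * (x * a N) ≤ meanDegree g W N i l ω ∧ (degree A N i l ω : ℝ) ≤ x * a N})
    (fun N i => ?_) ht (fun N i => ENNReal.toReal_le_of_le_ofReal (Real.exp_pos _).le
      (hG.measure_meanDegree_ge_degree_le i l hρ1.le (x * a N)))
    (ha.tendsto_mul_exp_chernoff h hx (one_pos.trans hρ1) hρ1.ne')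
  have hcast : Measurable ((↑) : ℕ → ℝ) := measurable_from_top
  exact (measurableSet_le measurable_const (hG.measurable_meanDegree i l).coe_nnreal_real).inter
    (measurableSet_le (hcast.comp (hG.measurable_degree i l)) measurable_const)

lemma IsMIRG.negligible_mismatch (hG : IsMIRG μ g W A)
    (h : RegularlyVaryingTail (marginalTail (μ.map (W 0)) l) α) (hg : IsConnectionFunction (g l))
    (hmean : Integrable (fun w : Cone L => (w l : ℝ)) (μ.map (W 0)) ∨
      Tendsto (fun x => g l x / x) atTop (𝓝 1)) (ht : Tendsto t atTop atTop)
    (ha : IsTailLevel (marginalTail (μ.map (W 0)) l) (fun N => N / t N) a) {x : ℝ} (hx : 0 < x) :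
    Negligible μ t fun N i ω => ¬ (x * a N < W i ω l ↔ x * a N < degree A N i l ω) := by
  intro ε hε
  have hε4 : 0 < ε / 4 := by positivity
  have ht0 := ht.eventually_gt_atTop 0
  have ha0 := ha.tendsto_atTop.eventually_gt_atTop 0
  have hweight := tailCountTendsto_weight hG.indep hG.identDistrib h ht ha
  obtain ⟨C, hC⟩ := hg.linear_bound
  obtain ⟨δ, hδ, hδ1, hgap⟩ := hweight.exists_whp_gap_le ha0 hx hε4
  obtain ⟨K, hK, htop⟩ := hweight.exists_whp_top_le h.index_pos hx hε4
  have hlow := hG.negligible_meanDegree_le_degree_ge h ht0 ha hx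
    (show 0 < 1 - δ / 2 by linarith) (by linarith) hε4
  have hhigh := hG.negligible_meanDegree_ge_degree_le h ht0 ha hx
    (show 1 < 1 + δ / 2 by linarith) hε4
  have hnear := whp_abs_meanDegree_sub_le hG.indep hG.identDistrib h hg hmean ht0 ha
    (show 0 < δ / 4 by positivity)
    (show 0 < (1 - δ / 2) / (C + 1) * x from mul_pos (div_pos (by linarith) (by positivity)) hx)
    (mul_pos (one_pos.trans_le hK) hx)
  simp only [mul_assoc] at hnear
  refine ((hnear.and (hgap.and htop)).and (hlow.and hhigh)).mono ?_
  filter_upwards [ha0] with N haN ω ⟨⟨hnearN, hgapN, htopN⟩, hlowN, hhighN⟩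
  have hcases : ∀ i : Fin N, _ := fun i => mismatch_cases hδ hδ1 hK C.coe_nonneg
    (mul_pos hx haN) (by exact_mod_cast meanDegree_le hC i ω) (hnearN i)
    (D := degree A N i l ω)
  refine (count_le_add hcases).trans ?_
  refine (add_le_add hgapN ((count_le_add fun _ => id).trans (add_le_add htopN
    ((count_le_add fun _ => id).trans (add_le_add hlowN hhighN))))).trans_eq ?_
  ring

lemma IsMIRG.tailCountTendsto_degree (hG : IsMIRG μ g W A)
    (h : RegularlyVaryingTail (marginalTail (μ.map (W 0)) l) α) (hg : IsConnectionFunction (g l))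
    (hmean : Integrable (fun w : Cone L => (w l : ℝ)) (μ.map (W 0)) ∨
      Tendsto (fun x => g l x / x) atTop (𝓝 1)) (ht : Tendsto t atTop atTop)
    (ha : IsTailLevel (marginalTail (μ.map (W 0)) l) (fun N => N / t N) a) :
    TailCountTendsto μ t a α fun N i ω => degree A N i l ω := fun _ hx =>
  (tailCountTendsto_weight hG.indep hG.identDistrib h ht ha hx).congr
    (hG.negligible_mismatch h hg hmean ht ha hx)

end Mismatch

/-! ### Empirical quantiles and the estimator -/

section Estimator

variable {Ω : Type*} {L : ℕ} {A : (N : ℕ) → Fin N → Fin N → Fin L → Ω → ℕ} {t : ℕ → ℕ} {N : ℕ}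
  {l : Fin L} {ω : Ω} {z : ℝ}

lemma empiricalCDF_eq (hN : 0 < N) (x : ℝ) :
    empiricalCDF A N l ω x = 1 - count (fun i : Fin N => x < degree A N i l ω) / N := by
  have hN' : (0 : ℝ) < N := Nat.cast_pos.2 hN
  have hcompl := count_and_not (p := fun _ : Fin N => True) (q := fun i => x < degree A N i l ω)
    fun _ _ => trivial
  simp only [count_true, true_and, not_lt] at hcompl
  rw [empiricalCDF, ← count_eq_card, hcompl]
  field_simp

lemma le_empiricalCDF_iff (hN : 0 < N) (x : ℝ) :
    1 - (t N : ℝ) / N ≤ empiricalCDF A N l ω x ↔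
      count (fun i : Fin N => x < degree A N i l ω) ≤ t N := by
  rw [empiricalCDF_eq hN, sub_le_sub_iff_left, div_le_div_iff_of_pos_right (Nat.cast_pos.2 hN)]

lemma empiricalQuantile_le (htN : t N < N)
    (hz : count (fun i : Fin N => z < degree A N i l ω) ≤ t N) :
    empiricalQuantile A t N l ω ≤ z := by
  have hN : 0 < N := by omega
  refine csInf_le ⟨0, fun x hx => ?_⟩ ((le_empiricalCDF_iff hN z).2 hz)
  by_contra! hx0
  have hall : count (fun _ : Fin N => True) ≤ count (fun i : Fin N => x < degree A N i l ω) :=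
    count_mono fun i _ => hx0.trans_le (Nat.cast_nonneg _)
  have hcount := hall.trans ((le_empiricalCDF_iff hN x).1 hx)
  rw [count_true, Nat.cast_le] at hcount
  omega

lemma le_empiricalQuantile (hN : 0 < N)
    (hz : t N < count (fun i : Fin N => z < degree A N i l ω)) :
    z ≤ empiricalQuantile A t N l ω := by
  refine le_csInf ⟨∑ i : Fin N, (degree A N i l ω : ℝ), ?_⟩ fun x hx => ?_
  · have hnone : ∀ i : Fin N, ¬ ∑ j : Fin N, (degree A N j l ω : ℝ) < degree A N i l ω :=
      fun i => not_lt.2 (Finset.single_le_sum (f := fun j : Fin N => (degree A N j l ω : ℝ))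
        (fun _ _ => Nat.cast_nonneg _) (Finset.mem_univ i))
    refine (le_empiricalCDF_iff hN _).2 ?_
    simp [count, hnone]
  · by_contra! hxz
    exact hz.not_ge ((count_mono fun i hi => hxz.trans hi).trans ((le_empiricalCDF_iff hN x).1 hx))

lemma utdEstimator_eq (s m : Fin L) :
    utdEstimator A t s m N ω =
      count (fun i : Fin N => empiricalQuantile A t N s ω < degree A N i s ω ∧
        empiricalQuantile A t N m ω < degree A N i m ω) /
      count (fun i : Fin N => empiricalQuantile A t N s ω < degree A N i s ω) := by
  rw [count_eq_card, count_eq_card]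
  rfl

end Estimator

section QuantileMismatch

variable {Ω : Type*} [MeasurableSpace Ω] {μ : Measure Ω} {L : ℕ}
  {A : (N : ℕ) → Fin N → Fin N → Fin L → Ω → ℕ} {l : Fin L} {t : ℕ → ℕ} {a : ℕ → ℝ} {α : ℝ}

lemma IsIntermediate.eventually_lt (ht : IsIntermediate t) : ∀ᶠ N in atTop, t N < N := by
  filter_upwards [ht.tendsto_ratio.eventually (gt_mem_nhds one_pos), eventually_gt_atTop 0]
    with N hratio hN
  rwa [div_lt_one (Nat.cast_pos.2 hN), Nat.cast_lt] at hratio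

lemma TailCountTendsto.whp_empiricalQuantile_mem_Icc [IsFiniteMeasure μ]
    (hD : TailCountTendsto μ t a α fun N i ω => degree A N i l ω) (hα : 0 < α)
    (ht : IsIntermediate t) {δ : ℝ} (hδ : 0 < δ) (hδ1 : δ < 1) : Whp μ fun N ω =>
      empiricalQuantile A t N l ω ∈ Set.Icc ((1 - δ) * a N) ((1 + δ) * a N) := by
  have hmany := (hD (sub_pos.2 hδ1)).whp_lt (ht.tendsto_atTop.eventually_gt_atTop 0)
    (Real.one_lt_rpow_of_pos_of_lt_one_of_neg (sub_pos.2 hδ1) (sub_lt_self 1 hδ)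
      (neg_neg_of_pos hα))
  have hfew := (hD (show 0 < 1 + δ by positivity)).whp_le
    (Real.rpow_lt_one_of_one_lt_of_neg (lt_add_of_pos_right 1 hδ) (neg_neg_of_pos hα))
  refine (hmany.and hfew).mono ?_
  filter_upwards [ht.eventually_lt] with N htN ω hω
  rw [one_mul] at hω
  exact ⟨le_empiricalQuantile (by omega) hω.1, empiricalQuantile_le htN hω.2⟩

lemma TailCountTendsto.negligible_empiricalQuantile_mismatch [IsFiniteMeasure μ]
    (hD : TailCountTendsto μ t a α fun N i ω => degree A N i l ω) (hα : 0 < α)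
    (ht : IsIntermediate t) (ha : ∀ᶠ N in atTop, 0 < a N) : Negligible μ t fun N i ω =>
      ¬ (a N < degree A N i l ω ↔ empiricalQuantile A t N l ω < degree A N i l ω) := by
  intro ε hε
  obtain ⟨δ, hδ, hδ1, hgap⟩ := hD.exists_whp_gap_le ha one_pos hε
  refine (hgap.and (hD.whp_empiricalQuantile_mem_Icc hα ht hδ hδ1)).mono ?_
  filter_upwards [ha] with N haN ω ⟨hgapN, hlow, hhigh⟩
  have hδa := mul_pos hδ haN
  refine (count_mono fun i hi => ?_).trans hgapN
  rw [one_mul, not_lt]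
  by_cases hq : empiricalQuantile A t N l ω < degree A N i l ω
  · have hdeg : (degree A N i l ω : ℝ) ≤ a N := not_lt.1 fun hdeg => hi (iff_of_true hdeg hq)
    constructor <;> linarith
  · have hdeg : a N < degree A N i l ω := not_le.1 fun hdeg => hi (iff_of_false hdeg.not_gt hq)
    constructor <;> linarith

lemma IsMIRG.negligible_empiricalQuantile_mismatch [IsProbabilityMeasure μ]
    {g : Fin L → ℝ≥0 → ℝ≥0} {W : ℕ → Ω → Cone L} (hG : IsMIRG μ g W A)
    (h : RegularlyVaryingTail (marginalTail (μ.map (W 0)) l) α) (hg : IsConnectionFunction (g l))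
    (hmean : ∫⁻ ω, (W 0 ω l : ℝ≥0∞) ∂μ < ∞ ∨ Tendsto (fun x => g l x / x) atTop (𝓝 1))
    (ht : IsIntermediate t)
    (ha : IsTailLevel (marginalTail (μ.map (W 0)) l) (fun N => N / t N) a) :
    Negligible μ t fun N i ω =>
      ¬ (a N < W i ω l ↔ empiricalQuantile A t N l ω < degree A N i l ω) := by
  have hmean' : Integrable (fun w : Cone L => (w l : ℝ)) (μ.map (W 0)) ∨ _ :=
    hmean.imp_left hG.integrable_coord
  have hweight := hG.negligible_mismatch h hg hmean' ht.tendsto_atTop ha one_pos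
  have hquantile := (hG.tailCountTendsto_degree h hg hmean' ht.tendsto_atTop
    ha).negligible_empiricalQuantile_mismatch h.index_pos ht
    (ha.tendsto_atTop.eventually_gt_atTop 0)
  simp only [one_mul] at hweight
  exact hweight.of_imp_or hquantile fun N i ω hi => by tauto

end QuantileMismatch

end MIRG

open MIRG in
theorem theorem3p1_general {Ω : Type*} [MeasurableSpace Ω] (μ : Measure Ω)
    [IsProbabilityMeasure μ] {L : ℕ} (g : Fin L → ℝ≥0 → ℝ≥0) (W : ℕ → Ω → Cone L)
    (A : (N : ℕ) → Fin N → Fin N → Fin L → Ω → ℕ) (hG : IsMIRG μ g W A)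
    (s m : Fin L) (α : Fin L → ℝ)
    (hW : ∀ l, l = s ∨ l = m → RegularlyVaryingTail (marginalTail (μ.map (W 0)) l) (α l))
    (hg : ∀ l, l = s ∨ l = m → IsConnectionFunction (g l))
    (hmean : ∀ l, l = s ∨ l = m →
      (∫⁻ ω, (W 0 ω l : ℝ≥0∞) ∂μ < ∞ ∨ Tendsto (fun x => g l x / x) atTop (𝓝 1)))
    (t : ℕ → ℕ) (ht : IsIntermediate t)
    (lam : ℝ) (hlam : IsUTDCoefficient (μ.map (W 0)) s m lam) :
    TendstoInMeasure μ (fun N => utdEstimator A t s m N) atTop (fun _ => lam) := by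
  have := Measure.isProbabilityMeasure_map (μ := μ) (hG.measurable_weight 0).aemeasurable
  let a (l : Fin L) (N : ℕ) := marginalQuantile (μ.map (W 0)) l (1 - ((N : ℝ) / t N)⁻¹)
  have hmismatch : ∀ l, l = s ∨ l = m → Negligible μ t fun N i ω =>
      ¬ (a l N < W i ω l ↔ empiricalQuantile A t N l ω < degree A N i l ω) :=
    fun l hl => hG.negligible_empiricalQuantile_mismatch (hW l hl) (hg l hl) (hmean l hl) ht
      (.of_marginalQuantile (hW l hl) ht.tendsto_div)
  have hs := hmismatch s (.inl rfl)
  have htail : CountTendsto μ t (fun N i ω => a s N < W i ω s) 1 :=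
    .of_tendsto_mul_measureReal hG.indep hG.identDistrib ht.tendsto_atTop
      (S := fun N => {w | a s N < w s}) (fun _ => measurableSet_lt_coe_coord s _)
      ((hW s (.inl rfl)).tendsto_mul_marginalTail ht.tendsto_div)
  have hjoint : CountTendsto μ t (fun N i ω => a s N < W i ω s ∧ a m N < W i ω m) lam :=
    .of_tendsto_mul_measureReal hG.indep hG.identDistrib ht.tendsto_atTop
      (S := fun N => {w | a s N < w s ∧ a m N < w m})
      (fun _ => (measurableSet_lt_coe_coord s _).inter (measurableSet_lt_coe_coord m _))
      ((hW s (.inl rfl)).tendsto_mul_joint_tail hlam ht.tendsto_div)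
  have hsm : Negligible μ t fun N i ω => ¬ (a s N < W i ω s ∧ a m N < W i ω m ↔
      empiricalQuantile A t N s ω < degree A N i s ω ∧
        empiricalQuantile A t N m ω < degree A N i m ω) :=
    hs.of_imp_or (hmismatch m (.inr rfl)) fun N i ω hi => by tauto
  simpa only [← utdEstimator_eq] using (hjoint.congr hsm).tendstoInMeasure_div
    (htail.congr hs) (ht.tendsto_atTop.eventually_gt_atTop 0)

theorem theorem3p1 {Ω : Type*} [MeasurableSpace Ω] (μ : Measure Ω) [IsProbabilityMeasure μ]
    {L : ℕ} (g : Fin L → ℝ≥0 → ℝ≥0) (W : ℕ → Ω → MIRG.Cone L)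
    (A : (N : ℕ) → Fin N → Fin N → Fin L → Ω → ℕ) (hG : MIRG.IsMIRG μ g W A)
    (α : ℝ) (hα : 0 < α) (b : ℝ≥0 → ℝ≥0) (ν : Measure (MIRG.Cone L))
    (hW : MIRG.MRV (μ.map (W 0)) α b ν)
    (s m : Fin L)
    (hν : ∀ l, l = s ∨ l = m → ν {x | 0 < x l} ≠ 0)
    (hg : ∀ l, l = s ∨ l = m → MIRG.IsConnectionFunction (g l))
    (hmean : ∀ l, l = s ∨ l = m →
      (∫⁻ ω, (W 0 ω l : ℝ≥0∞) ∂μ < ∞ ∨ Tendsto (fun x => g l x / x) atTop (𝓝 1)))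
    (t : ℕ → ℕ) (ht : MIRG.IsIntermediate t)
    (lam : ℝ) (hlam : MIRG.IsUTDCoefficient (μ.map (W 0)) s m lam) :
    TendstoInMeasure μ (fun N => MIRG.utdEstimator A t s m N) atTop (fun _ => lam) := by
  have := Measure.isProbabilityMeasure_map (μ := μ) (hG.measurable_weight 0).aemeasurable
  exact theorem3p1_general μ g W A hG s m (fun _ => α)
    (fun l hl => hW.regularlyVaryingTail (hν l hl)) hg hmean t ht lam hlam
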